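/- A \emph{partially $q$-colored graph} is a triple $(G,S,\phi)$, where $G=(V,E)$ is a finite simple graph, $S\subseteq V$ and $\phi:S\to[q]=\{1,\dots,q\}$; vertices in $S$ are called pinned, the others free, and the free degree of a vertex is its number of free neighbors. Its Potts partition function is \[ Z_G(w)=\sum_{\psi:V\to[q],\ \psi|_S=\phi} w^{m(\psi)}, \] where $m(\psi)$ is the number of edges $\{a,b\}\in E$ with $\psi(a)=\psi(b)$ (and $0^0=1$). For a free vertex $v$ and a color $j$, let $Z^j_{G,v}(w)$ be the same sum restricted to those $\psi$ with $\psi(v)=j$, and let \[ R_{G,v;i,j}(w)=\log\frac{Z^i_{G,v}(w)}{Z^j_{G,v}(w)}, \] where $\log$ is the principal branch of the logarithm on $\mathbb{C}\setminus(-\infty,0]$; $R_{G,v;i,j}(w)$ is called well defined if $Z^i_{G,v}(w)\neq 0$, $Z^j_{G,v}(w)\neq0$ and their quotient lies in $\mathbb{C}\setminus(-\infty,0]$. Let $\mathcal{G}^\bullet_{\Delta,q}$ be the class of pairs $(G,v)$, where $G$ is a connected partially $q$-colored graph of maximum degree at most $\Delta$ whose pinned vertices are all leaves (vertices of degree $1$)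 and form an independent set, and where $v$ is a free vertex of $G$. For $(G,v)\in\mathcal{G}^\bullet_{\Delta,q}$ let $\overline{G}$ be obtained from $G$ by removing all pinned neighbors of $v$. \textbf{Theorem.} There exist constants $\eta\ge 0.002$ and $C>0$ such that for all integers $\Delta\ge 3$ and $q\ge(2-\eta)\Delta$ there exist $\varepsilon_1>0$ and $\varepsilon_2>0$ with $\varepsilon_1\ge C\Delta^{-4}$ such that the following holds. If $(G,v)\in\mathcal{G}^\bullet_{\Delta,q}$ and $v$ has free degree at most $\Delta-1$, then for all colors $i,j\in[q]$, all $w\in[0,1]$ and all $\tilde w\in\mathbb{C}$ with $|\tilde w-w|<\varepsilon_1$, the log-ratios $R_{\overline{G},v;i,j}(w)$ and $R_{\overline{G},v;i,j}(\tilde w)$ are well defined, \[ Z_G(\tilde w)\neq 0\qquad\text{and}\qquad \bigl|R_{\overline{G},v;i,j}(\tilde w)-R_{\overline{G},v;i,j}(w)\bigr|\le\varepsilon_2 . \] -/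

import Mathlib

/-- A partially `q`-colored graph `(G, S, φ)` on the vertex type `V`: a graph together with a set
of pinned vertices and a color for each of them. -/
structure PartiallyColoredGraph (V : Type*) (q : ℕ) where
  /-- the underlying graph `G` -/
  graph : SimpleGraph V
  /-- the set `S` of pinned vertices; the other vertices are free -/
  pinned : Set V
  /-- the coloring `φ` of the pinned vertices -/
  color : pinned → Fin q

namespace PartiallyColoredGraph

/-- `ψ` coincides with the given coloring on the pinned vertices. -/
def Extends {V : Type*} {q : ℕ} (P : PartiallyColoredGraph V q) (ψ : V → Fin q) : Prop :=
  ∀ s : P.pinned, ψ s = P.color s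

/-- `m(ψ)`, the number of edges `{a, b}` of the graph with `ψ a = ψ b`. -/
noncomputable def numMono {V : Type*} {q : ℕ} (P : PartiallyColoredGraph V q)
    (ψ : V → Fin q) : ℕ :=
  {e : Sym2 V | e ∈ P.graph.edgeSet ∧ (e.map ψ).IsDiag}.ncard

open Classical in
/-- The partition function `Z_G(w)` of the Potts model. -/
noncomputable def Z {V : Type*} [Finite V] {q : ℕ} (P : PartiallyColoredGraph V q)
    (w : ℂ) : ℂ :=
  letI := Fintype.ofFinite V
  ∑ ψ : V → Fin q with P.Extends ψ, w ^ P.numMono ψ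

open Classical in
/-- `Z^j_{G,v}(w)`: the sum defining `Z_G(w)`, restricted to the `ψ` with `ψ v = j`. -/
noncomputable def ZAt {V : Type*} [Finite V] {q : ℕ} (P : PartiallyColoredGraph V q)
    (v : V) (j : Fin q) (w : ℂ) : ℂ :=
  letI := Fintype.ofFinite V
  ∑ ψ : V → Fin q with P.Extends ψ ∧ ψ v = j, w ^ P.numMono ψ

/-- The ratio `Z^i_{G,v}(w) / Z^j_{G,v}(w)`. -/
noncomputable def ratio {V : Type*} [Finite V] {q : ℕ} (P : PartiallyColoredGraph V q)
    (v : V) (i j : Fin q) (w : ℂ) : ℂ :=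
  P.ZAt v i w / P.ZAt v j w

/-- The log-ratio `R_{G,v;i,j}(w)`, with the branch of the logarithm that is real on the positive
real line. -/
noncomputable def logRatio {V : Type*} [Finite V] {q : ℕ} (P : PartiallyColoredGraph V q)
    (v : V) (i j : Fin q) (w : ℂ) : ℂ :=
  Complex.log (P.ratio v i j w)

/-- The log-ratio is well defined at `w`: both partition functions are nonzero and their quotient
lies in the domain `ℂ \ (-∞, 0]` of the branch of the logarithm. -/
def LogRatioDefined {V : Type*} [Finite V] {q : ℕ} (P : PartiallyColoredGraph V q)
    (v : V) (i j : Fin q) (w : ℂ) : Prop :=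
  P.ZAt v i w ≠ 0 ∧ P.ZAt v j w ≠ 0 ∧ P.ratio v i j w ∈ Complex.slitPlane

/-- The free degree of `v`: its number of free neighbors. -/
noncomputable def freeDegree {V : Type*} {q : ℕ} (P : PartiallyColoredGraph V q) (v : V) : ℕ :=
  {u : V | P.graph.Adj v u ∧ u ∉ P.pinned}.ncard

/-- The pair `(G, v)` belongs to the class `𝒢^•_{Δ,q}`: `G` is connected of maximum degree at most
`Δ`, `v` is free, and the pinned vertices are leaves that form an independent set. -/
structure IsRooted {V : Type*} {q : ℕ} (P : PartiallyColoredGraph V q) (Δ : ℕ) (v : V) :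
    Prop where
  connected : P.graph.Connected
  degree_le : ∀ u : V, (P.graph.neighborSet u).ncard ≤ Δ
  root_free : v ∉ P.pinned
  pinned_leaf : ∀ u ∈ P.pinned, (P.graph.neighborSet u).ncard = 1
  pinned_indep : P.graph.IsIndepSet P.pinned

/-- The partially colored graph induced on a set `A` of vertices. -/
def induce {V : Type*} {q : ℕ} (P : PartiallyColoredGraph V q) (A : Set V) :
    PartiallyColoredGraph A q where
  graph := P.graph.induce A
  pinned := {a : A | (a : V) ∈ P.pinned}
  color := fun a => P.color ⟨((a : A) : V), a.2⟩

/-- The vertices that remain when the pinned neighbors of `v` are removed. -/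
def barSet {V : Type*} {q : ℕ} (P : PartiallyColoredGraph V q) (v : V) : Set V :=
  {u : V | ¬ (P.graph.Adj v u ∧ u ∈ P.pinned)}

/-- The partially colored graph `Ḡ`, obtained from `(G, v)` by removing all pinned neighbors
of `v`. -/
def bar {V : Type*} {q : ℕ} (P : PartiallyColoredGraph V q) (v : V) :
    PartiallyColoredGraph (P.barSet v) q :=
  P.induce (P.barSet v)

/-- The root `v`, as a vertex of `Ḡ`. -/
def barRoot {V : Type*} {q : ℕ} (P : PartiallyColoredGraph V q) (v : V) : P.barSet v :=
  ⟨v, fun h => P.graph.irrefl h.1⟩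

end PartiallyColoredGraph

set_option linter.unusedSectionVars false

/-! Edges to pinned vertices are encoded as leaf counts `c u l`; deleting a vertex of color `l`
turns its edges into leaves of color `l` at its neighbors. The proof is an induction on the set of
free vertices (`Stable`). It controls, on a whole disc around `w`, the difference of the logarithmic
derivatives of the partition functions with a leaf of color `i`, respectively `j`, at a vertex of
degree below `Δ`: the difference is at most `M / (Δ - 1)`. Integrating such bounds
(`exists_exp_of_logDeriv_sub_le`) shows that ratios of partition functions hardly move on the disc,
so everything at `z` is a small perturbation of the real model at `w`, which is positive because `q
> Δ`.

For the step at `v`, let `y l` be the logarithmic derivative after deleting `v` with color `l`.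
Switching the leaves at its at most `Δ - 1` neighbors one by one (`Stable.exists_telescope`) gives
`‖y i - y j‖ ≤ M`. A leaf of color `i` at `v` multiplies the partition function by `1 - (1 - z) p
i`, with `p i` the marginal. Up to terms of order `Δ`, its logarithmic derivative is therefore the
average of `y` minus `gain (1 - w) (p i)` times the deviation of `y i` from that average, and the
gain is at most `1 / (q - Δ)`. For `q ≥ 2Δ` this contracts to `M / Δ`; the margin below `M / (Δ -
1)` absorbs all errors.

Below `2Δ` a second bound is carried along: the influence of a leaf is at most `M` times the sum of
the two gains, plus an error. Summed over the neighbors this telescopes (`sum_ratio_sub_one_le`) to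
a bound in terms of `W l`, the factor by which leaves of color `l` at the neighbors of `v` lower the
partition function without `v`. A gain near `1 / (Δ - 1)` forces `W i` near `1`; then `‖y i - y l‖`
is at most about `-M * log (W l)`, whose average over `l` is about `M * log 2 < M`. This is the
improvement used in `norm_gain_diff_le_contraction`. -/

namespace Potts

/-! ### The Potts model with leaf counts: recoloring and deleting a vertex. -/

variable {V : Type*} [Fintype V] [DecidableEq V] {q : ℕ}

/-- The neighbors of `v` in the graph with edge set `E`. -/
def nbr (E : Finset (Sym2 V)) (v : V) : Finset V := Finset.univ.filter fun u => s(v, u) ∈ E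

/-- The edges that avoid `v`. -/
def del (E : Finset (Sym2 V)) (v : V) : Finset (Sym2 V) := E.filter fun e => v ∉ e

/-- The exponent of a coloring in the Potts model on `E` in which every vertex `u` carries
`c u l` additional leaves of color `l`. -/
def expo (E : Finset (Sym2 V)) (c : V → Fin q → ℕ) (ψ : V → Fin q) : ℕ :=
  (E.filter fun e => (e.map ψ).IsDiag).card + ∑ u, c u (ψ u)

/-- The leaf counts `c` with one more leaf, of color `κ u`, at every `u ∈ X`. -/
def attach (c : V → Fin q → ℕ) (X : Finset V) (κ : V → Fin q) : V → Fin q → ℕ :=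
  fun u l => c u l + if u ∈ X ∧ κ u = l then 1 else 0

/-- The partition function over the colorings in `Ψ`. -/
def pf {R : Type*} [CommSemiring R] (Ψ : Finset (V → Fin q)) (E : Finset (Sym2 V))
    (c : V → Fin q → ℕ) (z : R) : R :=
  ∑ ψ ∈ Ψ, z ^ expo E c ψ

/-- The number of vertices in `X` on which `ψ` agrees with `κ`. -/
def agree (X : Finset V) (κ ψ : V → Fin q) : ℕ := (X.filter fun u => κ u = ψ u).card

theorem mem_nbr {E : Finset (Sym2 V)} {u v : V} : u ∈ nbr E v ↔ s(v, u) ∈ E := by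
  simp [nbr]

theorem expo_attach (E : Finset (Sym2 V)) (c : V → Fin q → ℕ) (X : Finset V)
    (κ ψ : V → Fin q) : expo E (attach c X κ) ψ = expo E c ψ + agree X κ ψ := by
  simp only [expo, attach, agree, Finset.sum_add_distrib, add_assoc]
  congr 2
  rw [Finset.card_filter, ← Finset.sum_filter, Finset.sum_filter]
  simp only [ite_and]
  rw [← Finset.sum_filter]
  simp

theorem pf_attach {R : Type*} [CommSemiring R] (Ψ : Finset (V → Fin q)) (E : Finset (Sym2 V))
    (c : V → Fin q → ℕ) (X : Finset V) (κ : V → Fin q) (z : R) :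
    pf Ψ E (attach c X κ) z = ∑ ψ ∈ Ψ, z ^ expo E c ψ * z ^ agree X κ ψ := by
  simp only [pf, expo_attach, pow_add]

/-- Once `v` has color `l`, an edge from `v` to `u` is monochromatic exactly when `u` has color `l`,
so it acts as a leaf at `u`. The count at `v` is reset to zero so that the remaining exponent does
not depend on `ψ v`. -/
theorem expo_update {E : Finset (Sym2 V)} (hE : ∀ e ∈ E, ¬ e.IsDiag) (c : V → Fin q → ℕ)
    (v : V) (l : Fin q) (ψ : V → Fin q) :
    expo E c (Function.update ψ v l) =
      c v l + expo (del E v) (attach (Function.update c v 0) (nbr E v) fun _ => l) ψ := by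
  rw [expo_attach]
  have h1 : ∑ u, c u (Function.update ψ v l u) =
      c v l + ∑ u, (Function.update c v 0) u (ψ u) := by
    rw [← Finset.add_sum_erase _ _ (Finset.mem_univ v),
      ← Finset.add_sum_erase _ (fun u => (Function.update c v 0) u (ψ u)) (Finset.mem_univ v)]
    simp only [Function.update_self, Pi.zero_apply, zero_add]
    congr 1
    refine Finset.sum_congr rfl fun u hu => ?_
    have := Finset.ne_of_mem_erase hu
    simp [Function.update_of_ne this]
  have h2 : (E.filter fun e => (e.map (Function.update ψ v l)).IsDiag).card =
      ((del E v).filter fun e => (e.map ψ).IsDiag).card + agree (nbr E v) (fun _ => l) ψ := by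
    rw [← Finset.card_filter_add_card_filter_not (s := E.filter _) (fun e => v ∉ e)]
    congr 1
    · rw [del, Finset.filter_filter, Finset.filter_filter]
      congr 1
      ext e
      simp only [Finset.mem_filter, and_congr_right_iff]
      intro he
      induction e with | _ a b
      simp only [Sym2.map_mk, Sym2.mk_isDiag_iff, Sym2.mem_iff, not_or]
      constructor
      · rintro ⟨h, h1, h2⟩
        rw [Function.update_of_ne (Ne.symm h1), Function.update_of_ne (Ne.symm h2)] at h
        exact ⟨⟨h1, h2⟩, h⟩
      · rintro ⟨⟨h1, h2⟩, h⟩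
        rw [Function.update_of_ne (Ne.symm h1), Function.update_of_ne (Ne.symm h2)]
        exact ⟨h, h1, h2⟩
    · rw [agree]
      symm
      refine Finset.card_bij (fun u _ => s(v, u)) ?_ ?_ ?_
      · intro u hu
        simp only [Finset.mem_filter, mem_nbr] at hu
        have : u ≠ v := by
          rintro rfl
          exact hE _ hu.1 (by simp)
        simp [hu.1, Function.update_of_ne this, hu.2]
      · intro a _ b _ h
        exact Sym2.congr_right.1 h
      · intro e he
        induction e with | _ a b
        simp only [Finset.mem_filter, Sym2.map_mk, Sym2.mk_isDiag_iff, Sym2.mem_iff,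
          not_not] at he
        obtain ⟨⟨hab, h⟩, rfl | rfl⟩ := he
        · have : b ≠ v := by
            rintro rfl
            exact hE _ hab (by simp)
          refine ⟨b, ?_, rfl⟩
          rw [Function.update_self, Function.update_of_ne this] at h
          simp [mem_nbr, hab, h]
        · have : a ≠ v := by
            rintro rfl
            exact hE _ hab (by simp)
          refine ⟨a, ?_, Sym2.eq_swap⟩
          rw [Function.update_self, Function.update_of_ne this] at h
          rw [Sym2.eq_swap] at hab
          simp [mem_nbr, hab, h]
  rw [expo, h1, h2, expo]
  ring

/-- `Ψ` is closed under recoloring the vertex `v`. -/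
def ClosedAt (Ψ : Finset (V → Fin q)) (v : V) : Prop :=
  ∀ ψ ∈ Ψ, ∀ l, Function.update ψ v l ∈ Ψ

/-- Each `ψ` with `ψ v = l` arises from exactly `q` elements of `Ψ` by recoloring `v`. The factor
`q` is the price of keeping deleted vertices in `V` with an irrelevant color; it cancels in ratios
and logarithmic derivatives. -/
theorem card_mul_sum_filter {R : Type*} [CommSemiring R] {Ψ : Finset (V → Fin q)} {v : V}
    (hΨ : ClosedAt Ψ v) (l : Fin q) (f : (V → Fin q) → R) :
    (q : R) * ∑ ψ ∈ Ψ with ψ v = l, f ψ = ∑ ψ ∈ Ψ, f (Function.update ψ v l) := by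
  have : ∀ m : Fin q, ∑ ψ ∈ Ψ with ψ v = m, f (Function.update ψ v l) =
      ∑ ψ ∈ Ψ with ψ v = l, f ψ := by
    intro m
    refine Finset.sum_bij' (fun ψ _ => Function.update ψ v l) (fun ψ _ => Function.update ψ v m)
      ?_ ?_ ?_ ?_ ?_
    · intro ψ h
      simp [hΨ ψ (Finset.mem_filter.1 h).1]
    · intro ψ h
      simp [hΨ ψ (Finset.mem_filter.1 h).1]
    · intro ψ h
      simp [← (Finset.mem_filter.1 h).2]
    · intro ψ h
      simp [← (Finset.mem_filter.1 h).2]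
    · simp
  rw [← Finset.sum_fiberwise Ψ (fun ψ => ψ v) fun ψ => f (Function.update ψ v l)]
  simp [this]

/-- Expansion of the partition function, restricted to `ψ v = l`, at the vertex `v`. -/
theorem card_mul_pf_at {R : Type*} [CommSemiring R] {Ψ : Finset (V → Fin q)} {v : V}
    (hΨ : ClosedAt Ψ v) {E : Finset (Sym2 V)} (hE : ∀ e ∈ E, ¬ e.IsDiag)
    (c : V → Fin q → ℕ) (l : Fin q) (z : R) :
    (q : R) * ∑ ψ ∈ Ψ with ψ v = l, z ^ expo E c ψ =
      z ^ c v l * pf Ψ (del E v) (attach (Function.update c v 0) (nbr E v) fun _ => l) z := by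
  rw [card_mul_sum_filter hΨ, pf, Finset.mul_sum]
  simp only [expo_update hE, pow_add]

theorem card_mul_pf {R : Type*} [CommSemiring R] {Ψ : Finset (V → Fin q)} {v : V}
    (hΨ : ClosedAt Ψ v) {E : Finset (Sym2 V)} (hE : ∀ e ∈ E, ¬ e.IsDiag)
    (c : V → Fin q → ℕ) (z : R) :
    (q : R) * pf Ψ E c z = ∑ l, z ^ c v l *
      pf Ψ (del E v) (attach (Function.update c v 0) (nbr E v) fun _ => l) z := by
  rw [pf, ← Finset.sum_fiberwise Ψ (fun ψ => ψ v), Finset.mul_sum]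
  exact Finset.sum_congr rfl fun l _ => card_mul_pf_at hΨ hE c l z

theorem ofReal_pf (Ψ : Finset (V → Fin q)) (E : Finset (Sym2 V)) (c : V → Fin q → ℕ) (w : ℝ) :
    ((pf Ψ E c w : ℝ) : ℂ) = pf Ψ E c (w : ℂ) := by
  simp [pf]

theorem differentiable_pf (Ψ : Finset (V → Fin q)) (E : Finset (Sym2 V)) (c : V → Fin q → ℕ) :
    Differentiable ℂ fun z : ℂ => pf Ψ E c z := by
  unfold pf
  fun_prop

/-- The edges of `E` and the leaves counted by `c` are at vertices in `A`, and degrees are at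
most `Δ`, leaves included. -/
structure Adm (Δ : ℕ) (A : Finset V) (E : Finset (Sym2 V)) (c : V → Fin q → ℕ) : Prop where
  loopless : ∀ e ∈ E, ¬ e.IsDiag
  supp : ∀ e ∈ E, ∀ u ∈ e, u ∈ A
  field : ∀ u ∉ A, c u = 0
  degree : ∀ u, (nbr E u).card + ∑ l, c u l ≤ Δ

theorem nbr_del_self (E : Finset (Sym2 V)) (v : V) : nbr (del E v) v = ∅ := by
  ext u; simp [mem_nbr, del]

theorem nbr_del {E : Finset (Sym2 V)} {v u : V} (h : u ≠ v) :
    nbr (del E v) u = (nbr E u).erase v := by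
  ext x
  simp only [mem_nbr, del, Finset.mem_filter, Sym2.mem_iff, not_or, Finset.mem_erase]
  constructor
  · rintro ⟨h1, -, h3⟩; exact ⟨Ne.symm h3, h1⟩
  · rintro ⟨h1, h2⟩; exact ⟨h2, Ne.symm h, Ne.symm h1⟩

theorem mem_nbr_comm {E : Finset (Sym2 V)} {u v : V} : u ∈ nbr E v ↔ v ∈ nbr E u := by
  rw [mem_nbr, mem_nbr, Sym2.eq_swap]

theorem not_mem_nbr_self {E : Finset (Sym2 V)} (hE : ∀ e ∈ E, ¬ e.IsDiag) (v : V) :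
    v ∉ nbr E v := fun h => hE _ (mem_nbr.1 h) (by simp)

theorem card_nbr_del_of_mem {E : Finset (Sym2 V)} {v u : V} (hE : ∀ e ∈ E, ¬ e.IsDiag)
    (h : u ∈ nbr E v) : (nbr (del E v) u).card + 1 = (nbr E u).card := by
  have : u ≠ v := by rintro rfl; exact not_mem_nbr_self hE _ h
  rw [nbr_del this, Finset.card_erase_add_one (mem_nbr_comm.1 h)]

theorem sum_attach (c : V → Fin q → ℕ) (X : Finset V) (κ : V → Fin q) (u : V) :
    ∑ l, attach c X κ u l = ∑ l, c u l + if u ∈ X then 1 else 0 := by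
  simp only [attach, Finset.sum_add_distrib]
  congr 1
  by_cases h : u ∈ X <;> simp [h]

/-- Removing `v` and attaching leaves to some of its neighbors. -/
theorem Adm.del {Δ : ℕ} {A : Finset V} {E : Finset (Sym2 V)} {c : V → Fin q → ℕ}
    (h : Adm Δ A E c) (v : V) {X : Finset V} (hX : X ⊆ nbr E v) (κ : V → Fin q) :
    Adm Δ (A.erase v) (del E v) (attach (Function.update c v 0) X κ) where
  loopless e he := h.loopless e (Finset.mem_filter.1 he).1
  supp e he u hu := by
    obtain ⟨he, hv⟩ := Finset.mem_filter.1 he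
    exact Finset.mem_erase.2 ⟨fun huv => hv (huv ▸ hu), h.supp e he u hu⟩
  field u hu := by
    have hX' : u ∉ X := by
      intro huX
      have h1 := mem_nbr.1 (hX huX)
      refine hu (Finset.mem_erase.2 ⟨?_, h.supp _ h1 u (by simp)⟩)
      rintro rfl
      exact not_mem_nbr_self h.loopless _ (hX huX)
    funext l
    simp only [attach, hX', false_and, if_false, add_zero, Pi.zero_apply]
    by_cases huv : u = v
    · subst huv; simp
    · rw [Function.update_of_ne huv, h.field u fun hA => hu (Finset.mem_erase.2 ⟨huv, hA⟩)]
      rfl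
  degree u := by
    rw [sum_attach]
    by_cases huv : u = v
    · subst huv
      have : u ∉ X := fun hu => not_mem_nbr_self h.loopless _ (hX hu)
      simp [nbr_del_self, this]
    · rw [Function.update_of_ne huv]
      have hd := h.degree u
      by_cases huX : u ∈ X
      · have := card_nbr_del_of_mem h.loopless (hX huX)
        simp only [huX, if_true]
        omega
      · have : (nbr (Potts.del E v) u).card ≤ (nbr E u).card := by
          rw [nbr_del huv]; exact Finset.card_le_card (Finset.erase_subset _ _)
        simp only [huX, if_false]
        omega

/-- A neighbor of the removed vertex to which no leaf was attached has lost one from its degree. -/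
theorem Adm.degree_del_lt {Δ : ℕ} {A : Finset V} {E : Finset (Sym2 V)} {c : V → Fin q → ℕ}
    (h : Adm Δ A E c) {v u : V} (hu : u ∈ nbr E v) {X : Finset V} (huX : u ∉ X)
    (κ : V → Fin q) :
    (nbr (Potts.del E v) u).card + ∑ l, attach (Function.update c v 0) X κ u l + 1 ≤ Δ := by
  have huv : u ≠ v := by rintro rfl; exact not_mem_nbr_self h.loopless _ hu
  rw [sum_attach, Function.update_of_ne huv]
  have := card_nbr_del_of_mem h.loopless hu
  have := h.degree u
  simp only [huX, if_false]
  omega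

/-- Used to see two consecutive hybrids of the telescope as one common configuration with a leaf
added at `u`. -/
theorem attach_attach_erase (c : V → Fin q → ℕ) {X : Finset V} {u : V} (hu : u ∈ X)
    {κ κ' : V → Fin q} (i : Fin q) (h : ∀ x ∈ X, x ≠ u → κ x = κ' x) (hi : κ' u = i) :
    attach (attach c (X.erase u) κ) {u} (fun _ => i) = attach c X κ' := by
  funext x l
  simp only [attach, add_assoc, Finset.mem_erase, Finset.mem_singleton]
  congr 1
  by_cases hx : x = u
  · subst hx; simp [hu, hi]
  · by_cases hX : x ∈ X
    · simp [hx, hX, h x hX hx]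
    · simp [hx, hX]

theorem attach_empty (c : V → Fin q → ℕ) (κ : V → Fin q) : attach c ∅ κ = c := by
  funext x l; simp [attach]

end Potts

/-! ### The real model on `[0, 1]`: positivity and the effect of leaves. -/

namespace Potts

variable {V : Type*} [Fintype V] [DecidableEq V] {q : ℕ}

section Real

variable {w : ℝ} {Ψ : Finset (V → Fin q)} {Δ : ℕ} {A : Finset V} {E : Finset (Sym2 V)}
  {c : V → Fin q → ℕ}

theorem pf_nonneg (hw : w ∈ Set.Icc (0 : ℝ) 1) : 0 ≤ pf Ψ E c w :=
  Finset.sum_nonneg fun _ _ => pow_nonneg hw.1 _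

theorem pf_attach_le (hw : w ∈ Set.Icc (0 : ℝ) 1) (X : Finset V) (κ : V → Fin q) :
    pf Ψ E (attach c X κ) w ≤ pf Ψ E c w := by
  rw [pf_attach, pf]
  refine Finset.sum_le_sum fun ψ _ => ?_
  exact mul_le_of_le_one_right (pow_nonneg hw.1 _) (pow_le_one₀ hw.1 hw.2)

theorem sum_agree_const (N : Finset V) (ψ : V → Fin q) :
    ∑ l, agree N (fun _ => l) ψ = N.card := by
  simp only [agree, Finset.card_filter]
  rw [Finset.sum_comm]
  simp

theorem one_sub_le_pow (hw : w ∈ Set.Icc (0 : ℝ) 1) (n : ℕ) : 1 - (n : ℝ) ≤ w ^ n := by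
  rcases n with _ | n
  · simp
  · have := pow_nonneg hw.1 (n + 1)
    push_cast
    have : (0 : ℝ) ≤ n := n.cast_nonneg
    linarith

/-- At least `q - deg v` colors are available at `v`. -/
theorem le_sum_pow_mul_pf (hw : w ∈ Set.Icc (0 : ℝ) 1) (E' : Finset (Sym2 V))
    (c' : V → Fin q → ℕ) (N : Finset V) (n : Fin q → ℕ) {δ : ℕ}
    (hδ : N.card + ∑ l, n l ≤ δ) :
    ((q : ℝ) - δ) * pf Ψ E' c' w ≤ ∑ l, w ^ n l * pf Ψ E' (attach c' N fun _ => l) w := by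
  simp only [pf_attach]
  simp only [pf, Finset.mul_sum]
  rw [Finset.sum_comm]
  refine Finset.sum_le_sum fun ψ _ => ?_
  have h0 := pow_nonneg hw.1 (expo E' c' ψ)
  have : ∑ l, w ^ n l * (w ^ expo E' c' ψ * w ^ agree N (fun _ => l) ψ) =
      (∑ l, w ^ (n l + agree N (fun _ => l) ψ)) * w ^ expo E' c' ψ := by
    rw [Finset.sum_mul]
    refine Finset.sum_congr rfl fun l _ => ?_
    rw [pow_add]; ring
  rw [this]
  refine mul_le_mul_of_nonneg_right ?_ h0
  -- For fixed `ψ`, a color met `n` times around the vertex still contributes `w ^ n ≥ 1 - n`, and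
  -- these multiplicities sum to at most `δ`.
  calc (q : ℝ) - δ ≤ ∑ l : Fin q, (1 - ((n l + agree N (fun _ => l) ψ : ℕ) : ℝ)) := by
        rw [Finset.sum_sub_distrib, ← Nat.cast_sum, Finset.sum_add_distrib, sum_agree_const]
        simp only [Finset.sum_const, Finset.card_univ, Fintype.card_fin, nsmul_eq_mul, mul_one]
        have : ((∑ l, n l + N.card : ℕ) : ℝ) ≤ δ := by exact_mod_cast (by omega)
        linarith
    _ ≤ _ := Finset.sum_le_sum fun l _ => one_sub_le_pow hw _

/-- Restoring a deleted vertex multiplies the total by at least a positive multiple of `q - Δ`, the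
number of colors always left available, so positivity survives even at `w = 0`. -/
theorem pf_pos (hw : w ∈ Set.Icc (0 : ℝ) 1) (hΨ : Ψ.Nonempty) (hq : Δ < q) :
    ∀ (A : Finset V) (_ : ∀ u ∈ A, ClosedAt Ψ u) (E : Finset (Sym2 V)) (c : V → Fin q → ℕ),
      Adm Δ A E c → 0 < pf Ψ E c w := by
  intro A
  induction A using Finset.strongInduction with
  | H A ih =>
    intro hA E c h
    rcases A.eq_empty_or_nonempty with rfl | ⟨v, hv⟩
    · have hE : E = ∅ := by
        refine Finset.eq_empty_of_forall_notMem fun e he => ?_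
        induction e with | _ a b
        simpa using h.supp _ he a (by simp)
      have hc : c = 0 := funext fun u => h.field u (by simp)
      subst hE hc
      simpa [pf, expo] using hΨ
    · have h1 := h.del v (Finset.empty_subset (nbr E v)) (fun u => ⟨0, by omega⟩)
      have h2 := ih _ (Finset.erase_ssubset hv) (fun u hu => hA u (Finset.mem_of_mem_erase hu))
        _ _ h1
      rw [attach_empty] at h2
      have h3 := le_sum_pow_mul_pf hw (Ψ := Ψ) (del E v) (Function.update c v 0) (nbr E v) (c v)
        (h.degree v)
      rw [← card_mul_pf (hA v hv) h.loopless] at h3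
      have hq' : (0 : ℝ) < (q : ℝ) - Δ := sub_pos.2 (by exact_mod_cast hq)
      have : 0 < (q : ℝ) * pf Ψ E c w := (mul_pos hq' h2).trans_le h3
      exact pos_of_mul_pos_right this (by positivity)

theorem update_attach_singleton (c : V → Fin q → ℕ) (u : V) (κ : V → Fin q) :
    Function.update (attach c {u} κ) u 0 = Function.update c u 0 := by
  funext x
  by_cases hx : x = u
  · subst hx; simp
  · funext l; simp [attach, hx]

theorem attach_singleton_self (c : V → Fin q → ℕ) (u : V) (i l : Fin q) :
    attach c {u} (fun _ => i) u l = c u l + if i = l then 1 else 0 := by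
  simp [attach]

/-- The effect of attaching one leaf. -/
theorem card_mul_pf_attach_singleton {R : Type*} [CommRing R] {v : V}
    (hΨ : ClosedAt Ψ v) (hE : ∀ e ∈ E, ¬ e.IsDiag) (c : V → Fin q → ℕ) (i : Fin q) (z : R) :
    (q : R) * pf Ψ E (attach c {v} fun _ => i) z =
      (q : R) * pf Ψ E c z - (1 - z) * (z ^ c v i *
        pf Ψ (del E v) (attach (Function.update c v 0) (nbr E v) fun _ => i) z) := by
  rw [card_mul_pf hΨ hE, card_mul_pf hΨ hE, update_attach_singleton]
  simp only [attach_singleton_self]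
  rw [← Finset.add_sum_erase _ _ (Finset.mem_univ i),
    ← Finset.add_sum_erase (a := i) _ (fun l => z ^ c v l * _) (Finset.mem_univ i)]
  have : ∀ l ∈ Finset.univ.erase i, z ^ (c v l + if i = l then 1 else 0) *
      pf Ψ (del E v) (attach (Function.update c v 0) (nbr E v) fun _ => l) z = z ^ c v l *
      pf Ψ (del E v) (attach (Function.update c v 0) (nbr E v) fun _ => l) z := by
    intro l hl
    simp [(Finset.ne_of_mem_erase hl).symm]
  rw [Finset.sum_congr rfl this]
  simp only [if_true, pow_succ]
  ring

/-- The leaf removes at most `Y`, the contribution of a single color, while degree at most `Δ - 1`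
leaves at least `(q - Δ + 1) * Y` in total. -/
theorem pf_le_mul_pf_attach_singleton (hw : w ∈ Set.Icc (0 : ℝ) 1) (hq : Δ < q) {v : V}
    (hΨ : ClosedAt Ψ v) (hE : ∀ e ∈ E, ¬ e.IsDiag)
    (hv : (nbr E v).card + ∑ l, c v l + 1 ≤ Δ) (i : Fin q) :
    pf Ψ E c w ≤ (1 + ((q : ℝ) - Δ)⁻¹) * pf Ψ E (attach c {v} fun _ => i) w := by
  have h1 := card_mul_pf_attach_singleton hΨ hE c i w
  have h2 := le_sum_pow_mul_pf hw (Ψ := Ψ) (del E v) (Function.update c v 0) (nbr E v) (c v)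
    (δ := Δ - 1) (by omega)
  rw [← card_mul_pf hΨ hE] at h2
  have hΔ : ((Δ - 1 : ℕ) : ℝ) = (Δ : ℝ) - 1 := by
    rw [Nat.cast_sub (by omega)]; simp
  rw [hΔ] at h2
  have h3 := pf_attach_le (Ψ := Ψ) (E := del E v) (c := Function.update c v 0) hw (nbr E v)
    (fun _ => i)
  set Y := pf Ψ (del E v) (Function.update c v 0) w
  set Xi := pf Ψ (del E v) (attach (Function.update c v 0) (nbr E v) fun _ => i) w
  have hXi : 0 ≤ Xi := pf_nonneg hw
  have h4 : (1 - w) * (w ^ c v i * Xi) ≤ Y := by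
    have hp : w ^ c v i * Xi ≤ Xi := mul_le_of_le_one_left hXi (pow_le_one₀ hw.1 hw.2)
    have hp' : 0 ≤ w ^ c v i * Xi := mul_nonneg (pow_nonneg hw.1 _) hXi
    have : (1 - w) * (w ^ c v i * Xi) ≤ w ^ c v i * Xi :=
      mul_le_of_le_one_left hp' (by linarith [hw.1])
    linarith
  have hq' : (0 : ℝ) < (q : ℝ) - Δ := sub_pos.2 (by exact_mod_cast hq)
  have hqp : (0 : ℝ) < q := by
    have : (0 : ℝ) ≤ Δ := Δ.cast_nonneg
    linarith
  set P := pf Ψ E c w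
  set P' := pf Ψ E (attach c {v} fun _ => i) w
  set t := (q : ℝ) - Δ with ht
  have h2' : (t + 1) * Y ≤ q * P := by
    have : (q : ℝ) - (Δ - 1) = t + 1 := by rw [ht]; ring
    rwa [this] at h2
  have h5 : q * P - Y ≤ q * P' := by linarith
  have h6 : t * (q * P) ≤ (t + 1) * (q * P') := by nlinarith
  have h7 : t * P ≤ (t + 1) * P' := by
    have : (q : ℝ) * (t * P) ≤ q * ((t + 1) * P') := by linarith
    exact le_of_mul_le_mul_left this hqp
  have h8 : (1 + t⁻¹) * P' = (t + 1) * P' / t := by field_simp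
  rw [h8, le_div_iff₀ hq']
  linarith

theorem pf_le_pow_mul_pf_attach (hw : w ∈ Set.Icc (0 : ℝ) 1) (hq : Δ < q)
    (hA : ∀ u ∈ A, ClosedAt Ψ u) (h : Adm Δ A E c) {v : V} (κ : V → Fin q) (X : Finset V)
    (hX : X ⊆ nbr E v) :
    pf Ψ (del E v) (Function.update c v 0) w ≤ (1 + ((q : ℝ) - Δ)⁻¹) ^ X.card *
      pf Ψ (del E v) (attach (Function.update c v 0) X κ) w := by
  have hq' : (0 : ℝ) < (q : ℝ) - Δ := sub_pos.2 (by exact_mod_cast hq)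
  induction X using Finset.induction_on with
  | empty => simp [attach_empty]
  | insert u X hu ih =>
    have huN : u ∈ nbr E v := hX (Finset.mem_insert_self _ _)
    have hX' : X ⊆ nbr E v := (Finset.subset_insert _ _).trans hX
    have h1 := pf_le_mul_pf_attach_singleton hw hq
      (hA u (h.supp _ (mem_nbr.1 huN) u (by simp))) (h.del v hX' κ).loopless
      (h.degree_del_lt huN hu κ) (κ u)
    have h2 := attach_attach_erase (Function.update c v 0) (Finset.mem_insert_self u X)
      (κ := κ) (κ' := κ) (κ u) (fun _ _ _ => rfl) rfl
    rw [Finset.erase_insert hu] at h2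
    rw [h2] at h1
    rw [Finset.card_insert_of_notMem hu, pow_succ, mul_assoc]
    exact (ih hX').trans (mul_le_mul_of_nonneg_left h1 (by positivity))

end Real

/-- The two telescoping estimates behind the second-order bound. -/
theorem sum_ratio_sub_one_le {d : ℕ} {f m g : ℕ → ℝ} {r : ℝ} (hf : ∀ k, 0 < f k)
    (hf' : ∀ k ≤ d, g 0 ≤ 3 * f k) (hg : g d = f d) (hgd : g d ≤ g 0)
    (h1 : ∀ k < d, f (k + 1) ≤ m k) (h2 : ∀ k < d, f k ≤ m k)
    (h3 : ∀ k < d, m k ≤ r * f k)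
    (h4 : ∀ k < d, m k - f (k + 1) ≤ g k - g (k + 1)) :
    ∑ k ∈ Finset.range d, ((m k / f (k + 1) - 1) + (m k / f k - 1)) ≤
      (1 + r) * (3 * (1 - f d / g 0)) - r * Real.log (f 0 / g 0) := by
  have hg0 : 0 < g 0 := by have := hf d; linarith
  -- In the application `f k` has leaves at all neighbors, the first `k` of color `i` and the others
  -- of color `j`; `m k` lacks the leaf with index `k`; `g k` has the first `k` leaves only.
  -- Replacing the denominator by `g 0 / 3` makes the sum telescope through `g`.
  have ha : ∑ k ∈ Finset.range d, (m k / f (k + 1) - 1) ≤ 3 * (1 - f d / g 0) := by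
    have : ∀ k ∈ Finset.range d, m k / f (k + 1) - 1 ≤ 3 / g 0 * (g k - g (k + 1)) := by
      intro k hk
      have hk := Finset.mem_range.1 hk
      have e1 : m k / f (k + 1) - 1 = (m k - f (k + 1)) / f (k + 1) := by
        rw [sub_div, div_self (hf _).ne']
      rw [e1, div_le_iff₀ (hf _)]
      have e2 := h4 k hk
      have e3 := h1 k hk
      have e4 : 1 ≤ 3 / g 0 * f (k + 1) := by
        rw [div_mul_eq_mul_div, le_div_iff₀ hg0]; linarith [hf' (k + 1) hk]
      nlinarith
    refine (Finset.sum_le_sum this).trans ?_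
    rw [← Finset.mul_sum, Finset.sum_range_sub', hg]
    apply le_of_eq
    field_simp
  -- Nonnegativity of `r` can be extracted only from an actual index `k < d`.
  rcases Nat.eq_zero_or_pos d with rfl | hd
  · simp only [Finset.range_zero, Finset.sum_empty]
    rw [hg, div_self (hf 0).ne']
    simp
  have hr : 0 ≤ r := by
    by_contra hr
    push Not at hr
    have := h2 0 hd
    have := h3 0 hd
    nlinarith [hf 0]
  -- For `1 ≤ x ≤ r` one has `x - 1 ≤ r * log x`; passing to logarithms trades `m k / f k` for `m k
  -- / f (k + 1)`, bounded above, and a telescoping difference.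
  have hb : ∑ k ∈ Finset.range d, (m k / f k - 1) ≤
      r * (3 * (1 - f d / g 0) - Real.log (f 0 / g 0)) := by
    have : ∀ k ∈ Finset.range d, m k / f k - 1 ≤
        r * ((m k / f (k + 1) - 1) + (Real.log (f (k + 1)) - Real.log (f k))) := by
      intro k hk
      have hk := Finset.mem_range.1 hk
      have hm : 0 < m k := (hf k).trans_le (h2 k hk)
      have e1 : m k / f k - 1 ≤ r * (1 - (m k / f k)⁻¹) := by
        have : m k / f k ≤ r := by rw [div_le_iff₀ (hf k)]; exact h3 k hk
        have h0 : 1 ≤ m k / f k := by rw [le_div_iff₀ (hf k)]; linarith [h2 k hk]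
        have : m k / f k - 1 = m k / f k * (1 - (m k / f k)⁻¹) := by
          rw [mul_sub, mul_one, mul_inv_cancel₀ (by positivity)]
        rw [this]
        refine mul_le_mul_of_nonneg_right ‹_› ?_
        have := inv_le_one_of_one_le₀ h0
        linarith
      refine e1.trans (mul_le_mul_of_nonneg_left ?_ hr)
      have e2 := Real.one_sub_inv_le_log_of_pos (div_pos hm (hf k))
      have e3 := Real.log_le_sub_one_of_pos (div_pos hm (hf (k + 1)))
      rw [Real.log_div hm.ne' (hf _).ne'] at e2 e3
      linarith
    refine (Finset.sum_le_sum this).trans ?_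
    rw [← Finset.mul_sum, Finset.sum_add_distrib,
      Finset.sum_range_sub fun k => Real.log (f k)]
    refine mul_le_mul_of_nonneg_left ?_ hr
    rw [Real.log_div (hf 0).ne' hg0.ne']
    have : Real.log (f d) ≤ Real.log (g 0) := Real.log_le_log (hf d) (hg ▸ hgd)
    linarith
  rw [Finset.sum_add_distrib]
  linarith

end Potts

/-! ### Perturbing the weights at one vertex from `w` to `z`. -/

namespace Potts

variable {ι : Type*} [Fintype ι]

theorem norm_pow_sub_pow_le {z : ℂ} {w ε : ℝ} (hw : w ∈ Set.Icc (0 : ℝ) 1) (hz : ‖z - w‖ ≤ ε)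
    {n Δ : ℕ} (hn : n ≤ Δ) (hε : Δ * ε ≤ 1 / 2) :
    ‖z ^ n‖ ≤ 2 ∧ ‖z ^ n - (w : ℂ) ^ n‖ ≤ 2 * n * ε := by
  have hε0 : 0 ≤ ε := (norm_nonneg _).trans hz
  have hw1 : ‖(w : ℂ)‖ ≤ 1 := by
    rw [Complex.norm_real, Real.norm_of_nonneg hw.1]; exact hw.2
  have hz1 : ‖z‖ ≤ 1 + ε := by
    calc ‖z‖ = ‖(w : ℂ) + (z - w)‖ := by ring_nf
      _ ≤ 1 + ε := (norm_add_le _ _).trans (add_le_add hw1 hz)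
  have key : ∀ k ≤ Δ, ‖z ^ k‖ ≤ 2 := by
    intro k hk
    rw [norm_pow]
    have h1 : ‖z‖ ^ k ≤ (Real.exp ε) ^ k :=
      pow_le_pow_left₀ (norm_nonneg _) (hz1.trans (by linarith [Real.add_one_le_exp ε])) _
    rw [← Real.exp_nat_mul] at h1
    have h2 : (k : ℝ) * ε ≤ 1 / 2 :=
      (mul_le_mul_of_nonneg_right (by exact_mod_cast hk) hε0).trans hε
    have h3 : Real.exp (k * ε) ≤ 2 := by
      refine (Real.exp_le_exp.2 h2).trans ?_
      have : Real.exp (1 / 2) ^ 2 ≤ 2 ^ 2 := by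
        rw [← Real.exp_nat_mul]
        norm_num
        linarith [Real.exp_one_lt_d9]
      exact le_of_sq_le_sq this (by norm_num)
    exact h1.trans h3
  refine ⟨key n hn, ?_⟩
  rw [← Commute.geom_sum₂_mul (Commute.all z (w : ℂ)) n, norm_mul]
  refine mul_le_mul ?_ hz (norm_nonneg _) (by positivity)
  refine (norm_sum_le _ _).trans ?_
  calc ∑ i ∈ Finset.range n, ‖z ^ i * (w : ℂ) ^ (n - 1 - i)‖ ≤ ∑ i ∈ Finset.range n, 2 := by
        refine Finset.sum_le_sum fun i hi => ?_
        rw [norm_mul, norm_pow (w : ℂ)]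
        have := key i (by have := Finset.mem_range.1 hi; omega)
        calc _ ≤ 2 * 1 := mul_le_mul this (pow_le_one₀ (norm_nonneg _) hw1) (by positivity)
              (by norm_num)
          _ = 2 := by norm_num
    _ = 2 * n := by simp [mul_comm]

section Vertex

variable {W : ι → ℝ} {c : ι → ℕ} {ρ : ι → ℂ} {z : ℂ} {w ε τ : ℝ} {Δ : ℕ}

/-- The error is relative to the total weight, so the number of colors does not enter: changing the
powers costs a multiple of `∑ c l ≤ Δ`, absorbed by `hS`, and the `ρ l` perturb each weight
proportionally. -/
theorem sum_norm_weight_sub_le (hw : w ∈ Set.Icc (0 : ℝ) 1) (hz : ‖z - w‖ ≤ ε)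
    (hε : Δ * ε ≤ 1 / 2) (hc : ∑ l, c l ≤ Δ) (hW0 : ∀ l, 0 ≤ W l) (hW1 : ∀ l, W l ≤ 1)
    (hρ : ∀ l, ‖ρ l - 1‖ ≤ τ) (hτ : τ ≤ 1) (hS : 1 ≤ ∑ l, w ^ c l * W l) :
    ∑ l, ‖z ^ c l * W l * ρ l - ((w ^ c l * W l : ℝ) : ℂ)‖ ≤
      (4 * Δ * ε + τ) * ∑ l, w ^ c l * W l := by
  have hε0 : 0 ≤ ε := (norm_nonneg _).trans hz
  have hcl : ∀ l, c l ≤ Δ := fun l =>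
    (Finset.single_le_sum (fun _ _ => Nat.zero_le _) (Finset.mem_univ l)).trans hc
  have h1 : ∀ l, ‖z ^ c l * W l * ρ l - ((w ^ c l * W l : ℝ) : ℂ)‖ ≤
      4 * ε * c l + τ * (w ^ c l * W l) := by
    intro l
    have e : z ^ c l * W l * ρ l - ((w ^ c l * W l : ℝ) : ℂ) =
        (z ^ c l - (w : ℂ) ^ c l) * ρ l * W l + (ρ l - 1) * ((w ^ c l * W l : ℝ) : ℂ) := by
      push_cast; ring
    rw [e]
    refine (norm_add_le _ _).trans (add_le_add ?_ ?_)
    · rw [norm_mul, norm_mul, Complex.norm_real, Real.norm_of_nonneg (hW0 l)]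
      have hρ2 : ‖ρ l‖ ≤ 2 := by
        calc ‖ρ l‖ = ‖1 + (ρ l - 1)‖ := by ring_nf
          _ ≤ 1 + 1 := (norm_add_le _ _).trans (by
            rw [norm_one]; linarith [hρ l])
          _ = 2 := by norm_num
      have h2 := (norm_pow_sub_pow_le hw hz (hcl l) hε).2
      calc _ ≤ 2 * (c l) * ε * 2 * 1 := by
            refine mul_le_mul (mul_le_mul h2 hρ2 (norm_nonneg _) (by positivity)) (hW1 l)
              (hW0 l) (by positivity)
        _ = _ := by ring
    · rw [norm_mul, Complex.norm_real, Real.norm_of_nonneg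
        (mul_nonneg (pow_nonneg hw.1 _) (hW0 l))]
      exact mul_le_mul_of_nonneg_right (hρ l) (mul_nonneg (pow_nonneg hw.1 _) (hW0 l))
  refine (Finset.sum_le_sum fun l _ => h1 l).trans ?_
  rw [Finset.sum_add_distrib, ← Finset.mul_sum, ← Finset.mul_sum, add_mul]
  refine add_le_add ?_ le_rfl
  have hc' : ∑ l, (c l : ℝ) ≤ Δ := by exact_mod_cast hc
  have : 4 * ε * ∑ l, (c l : ℝ) ≤ 4 * ε * Δ := mul_le_mul_of_nonneg_left hc' (by positivity)
  calc _ ≤ 4 * Δ * ε * 1 := by linarith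
    _ ≤ _ := mul_le_mul_of_nonneg_left hS (by positivity)

theorem half_le_norm_sum_weight (hw : w ∈ Set.Icc (0 : ℝ) 1) (hz : ‖z - w‖ ≤ ε)
    (hε : Δ * ε ≤ 1 / 2) (hc : ∑ l, c l ≤ Δ) (hW0 : ∀ l, 0 ≤ W l) (hW1 : ∀ l, W l ≤ 1)
    (hρ : ∀ l, ‖ρ l - 1‖ ≤ τ) (hτ : 4 * Δ * ε + τ ≤ 1 / 2) (hS : 1 ≤ ∑ l, w ^ c l * W l) :
    (∑ l, w ^ c l * W l) / 2 ≤ ‖∑ l, z ^ c l * W l * ρ l‖ := by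
  have hε0 : 0 ≤ ε := (norm_nonneg _).trans hz
  have hτ1 : τ ≤ 1 := by
    have : 0 ≤ 4 * Δ * ε := by positivity
    linarith
  have h1 := sum_norm_weight_sub_le hw hz hε hc hW0 hW1 hρ hτ1 hS
  set S := ∑ l, w ^ c l * W l with hSdef
  have h2 : ‖(S : ℂ)‖ - ‖∑ l, z ^ c l * W l * ρ l‖ ≤ 1 / 2 * S := by
    have : (S : ℂ) = ∑ l, ((w ^ c l * W l : ℝ) : ℂ) := by rw [hSdef]; push_cast; rfl
    rw [this]
    refine (norm_sub_norm_le _ _).trans ?_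
    rw [norm_sub_rev, ← Finset.sum_sub_distrib]
    refine (norm_sum_le _ _).trans (h1.trans ?_)
    exact mul_le_mul_of_nonneg_right hτ (by linarith)
  rw [Complex.norm_real, Real.norm_of_nonneg (by linarith)] at h2
  linarith

/-- Numerators and normalization each move by at most `4 * Δ * ε + τ` times the total weight, and
the complex normalization is at least half of that weight; hence the factor `4`. -/
theorem sum_norm_marginal_sub_le (hw : w ∈ Set.Icc (0 : ℝ) 1) (hz : ‖z - w‖ ≤ ε)
    (hε : Δ * ε ≤ 1 / 2) (hc : ∑ l, c l ≤ Δ) (hW0 : ∀ l, 0 ≤ W l) (hW1 : ∀ l, W l ≤ 1)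
    (hρ : ∀ l, ‖ρ l - 1‖ ≤ τ) (hτ : 4 * Δ * ε + τ ≤ 1 / 2) (hS : 1 ≤ ∑ l, w ^ c l * W l) :
    ∑ l, ‖z ^ c l * W l * ρ l / (∑ m, z ^ c m * W m * ρ m) -
      ((w ^ c l * W l / (∑ m, w ^ c m * W m) : ℝ) : ℂ)‖ ≤ 4 * (4 * Δ * ε + τ) := by
  have hε0 : 0 ≤ ε := (norm_nonneg _).trans hz
  have hτ1 : τ ≤ 1 := by
    have : 0 ≤ 4 * Δ * ε := by positivity
    linarith
  have h1 := sum_norm_weight_sub_le hw hz hε hc hW0 hW1 hρ hτ1 hS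
  have h2 := half_le_norm_sum_weight hw hz hε hc hW0 hW1 hρ hτ hS
  set S := ∑ l, w ^ c l * W l with hSdef
  set Sz := ∑ l, z ^ c l * W l * ρ l with hSz
  have hS0 : 0 < S := by linarith
  have hSz0 : 0 < ‖Sz‖ := by linarith
  have hSz1 : Sz ≠ 0 := norm_pos_iff.1 hSz0
  have hSc : (S : ℂ) ≠ 0 := by exact_mod_cast hS0.ne'
  have h3 : ‖Sz - S‖ ≤ (4 * Δ * ε + τ) * S := by
    have : (S : ℂ) = ∑ l, ((w ^ c l * W l : ℝ) : ℂ) := by rw [hSdef]; push_cast; rfl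
    rw [this, hSz, ← Finset.sum_sub_distrib]
    exact (norm_sum_le _ _).trans h1
  have h4 : ∀ l, ‖z ^ c l * W l * ρ l / Sz - ((w ^ c l * W l / S : ℝ) : ℂ)‖ ≤
      (‖z ^ c l * W l * ρ l - ((w ^ c l * W l : ℝ) : ℂ)‖ +
        (w ^ c l * W l / S) * ‖Sz - S‖) / ‖Sz‖ := by
    intro l
    have hp : 0 ≤ w ^ c l * W l / S := by
      have := hW0 l
      have := hw.1
      positivity
    have e : z ^ c l * W l * ρ l / Sz - ((w ^ c l * W l / S : ℝ) : ℂ) =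
        ((z ^ c l * W l * ρ l - ((w ^ c l * W l : ℝ) : ℂ)) -
          ((w ^ c l * W l / S : ℝ) : ℂ) * (Sz - S)) / Sz := by
      push_cast
      field_simp
      ring
    rw [e, norm_div]
    refine div_le_div_of_nonneg_right ((norm_sub_le _ _).trans ?_) hSz0.le
    rw [norm_mul, Complex.norm_real, Real.norm_of_nonneg hp]
  refine (Finset.sum_le_sum fun l _ => h4 l).trans ?_
  rw [← Finset.sum_div, Finset.sum_add_distrib, ← Finset.sum_mul, ← Finset.sum_div,
    ← hSdef, div_self hS0.ne', one_mul, div_le_iff₀ hSz0]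
  have : 0 ≤ 4 * Δ * ε + τ := by
    by_contra hn
    push Not at hn
    have := norm_nonneg (Sz - S)
    nlinarith
  nlinarith

/-- These terms come from differentiating `z ^ c l`. For `c l = 0` the truncated exponent `c l - 1`
is harmless, as the factor `c l` vanishes. -/
theorem sum_norm_explicit_le (hw : w ∈ Set.Icc (0 : ℝ) 1) (hz : ‖z - w‖ ≤ ε)
    (hε : Δ * ε ≤ 1 / 2) (hc : ∑ l, c l ≤ Δ) (hW0 : ∀ l, 0 ≤ W l) (hW1 : ∀ l, W l ≤ 1)
    (hρ : ∀ l, ‖ρ l - 1‖ ≤ τ) (hτ : 4 * Δ * ε + τ ≤ 1 / 2) (hS : 1 ≤ ∑ l, w ^ c l * W l) :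
    ∑ l, ‖c l * z ^ (c l - 1) * W l * ρ l / (∑ m, z ^ c m * W m * ρ m)‖ ≤ 8 * Δ := by
  have hε0 : 0 ≤ ε := (norm_nonneg _).trans hz
  have hτ1 : τ ≤ 1 := by
    have : 0 ≤ 4 * Δ * ε := by positivity
    linarith
  have h2 := half_le_norm_sum_weight hw hz hε hc hW0 hW1 hρ hτ hS
  set S := ∑ l, w ^ c l * W l with hSdef
  set Sz := ∑ l, z ^ c l * W l * ρ l with hSz
  have hSz0 : 1 / 2 ≤ ‖Sz‖ := by linarith
  have hcl : ∀ l, c l ≤ Δ := fun l =>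
    (Finset.single_le_sum (fun _ _ => Nat.zero_le _) (Finset.mem_univ l)).trans hc
  have h1 : ∀ l, ‖c l * z ^ (c l - 1) * W l * ρ l / Sz‖ ≤ 8 * c l := by
    intro l
    have hρ2 : ‖ρ l‖ ≤ 2 := by
      calc ‖ρ l‖ = ‖1 + (ρ l - 1)‖ := by ring_nf
        _ ≤ 1 + 1 := (norm_add_le _ _).trans (by
          rw [norm_one]; linarith [hρ l])
        _ = 2 := by norm_num
    have h3 := (norm_pow_sub_pow_le hw hz ((Nat.sub_le _ 1).trans (hcl l)) hε).1
    rw [norm_div, div_le_iff₀ (by linarith), norm_mul, norm_mul, norm_mul, Complex.norm_real,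
      Real.norm_of_nonneg (hW0 l), Complex.norm_natCast]
    calc _ ≤ (c l : ℝ) * 2 * 1 * 2 := by
          refine mul_le_mul (mul_le_mul (mul_le_mul_of_nonneg_left h3 (by positivity)) (hW1 l)
            (hW0 l) (by positivity)) hρ2 (norm_nonneg _) (by positivity)
      _ = 8 * c l * (1 / 2) := by ring
      _ ≤ _ := mul_le_mul_of_nonneg_left hSz0 (by positivity)
  refine (Finset.sum_le_sum fun l _ => h1 l).trans ?_
  rw [← Finset.mul_sum]
  have hc' : ∑ l, (c l : ℝ) ≤ Δ := by exact_mod_cast hc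
  linarith

end Vertex

end Potts

/-! ### Logarithmic derivatives and the effect of a leaf. -/

namespace Potts

/-- Functions whose logarithmic derivatives are close have nearly proportional values. -/
theorem exists_exp_of_logDeriv_sub_le {X Y : ℂ → ℂ} (hX : Differentiable ℂ X)
    (hY : Differentiable ℂ Y) {w : ℂ} {ε M : ℝ} (hX0 : ∀ z ∈ Metric.ball w ε, X z ≠ 0)
    (hY0 : ∀ z ∈ Metric.ball w ε, Y z ≠ 0)
    (hM : ∀ z ∈ Metric.ball w ε, ‖logDeriv X z - logDeriv Y z‖ ≤ M)
    {z : ℂ} (hz : z ∈ Metric.ball w ε) :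
    ∃ s : ℂ, ‖s‖ ≤ M * ‖z - w‖ ∧ X z / Y z = X w / Y w * Complex.exp s := by
  have hwb : w ∈ Metric.ball w ε := Metric.mem_ball_self (dist_nonneg.trans_lt hz)
  have hd : DifferentiableOn ℂ (fun z => logDeriv X z - logDeriv Y z) (Metric.ball w ε) := by
    have e1 : DifferentiableOn ℂ (deriv X) (Metric.ball w ε) :=
      (hX.differentiableOn (s := Set.univ)).deriv isOpen_univ |>.mono (Set.subset_univ _)
    have e2 : DifferentiableOn ℂ (deriv Y) (Metric.ball w ε) :=
      (hY.differentiableOn (s := Set.univ)).deriv isOpen_univ |>.mono (Set.subset_univ _)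
    exact (e1.div hX.differentiableOn hX0).sub (e2.div hY.differentiableOn hY0)
  -- A primitive on the disc replaces the logarithm of `X / Y`, so no branch has to be chosen.
  obtain ⟨g, hg⟩ := hd.isExactOn_ball
  refine ⟨g z - g w, ?_, ?_⟩
  · exact (convex_ball w ε).norm_image_sub_le_of_norm_hasDerivWithin_le
      (fun x hx => (hg x hx).hasDerivWithinAt) hM hwb hz
  · have hder : ∀ x ∈ Metric.ball w ε,
        HasDerivAt (fun z => X z / Y z * Complex.exp (-g z)) 0 x := by
      intro x hx
      have h1 := ((hX x).hasDerivAt.div (hY x).hasDerivAt (hY0 x hx)).mul ((hg x hx).neg.cexp)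
      refine h1.congr_deriv ?_
      simp only [Pi.div_apply, Pi.neg_apply, logDeriv_apply]
      have := hX0 x hx
      have := hY0 x hx
      field_simp
      ring
    have hconst : X z / Y z * Complex.exp (-g z) = X w / Y w * Complex.exp (-g w) := by
      have := (convex_ball w ε).norm_image_sub_le_of_norm_hasDerivWithin_le (C := 0)
        (fun x hx => (hder x hx).hasDerivWithinAt) (by simp) hwb hz
      simpa [sub_eq_zero] using this
    rw [sub_eq_neg_add, Complex.exp_add, ← mul_assoc, ← hconst, mul_assoc, ← Complex.exp_add]
    simp

variable {ι : Type*} [Fintype ι]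

/-- The logarithmic derivative of the partition function with one leaf of color `i` added at a
vertex, in terms of the marginals `p`, the logarithmic derivatives `y` of the conditional
partition functions and the contributions `e` of the leaves at that vertex. -/
noncomputable def leafLogDeriv (z : ℂ) (p y e : ι → ℂ) (i : ι) : ℂ :=
  ∑ l, p l * y l - (1 - z) * p i / (1 - (1 - z) * p i) * (y i - ∑ l, p l * y l) +
    (p i + ∑ l, e l - (1 - z) * e i) / (1 - (1 - z) * p i)

theorem logDeriv_leaf {X : ι → ℂ → ℂ} (hX : ∀ l, Differentiable ℂ (X l)) (c : ι → ℕ) {z : ℂ}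
    (hX0 : ∀ l, X l z ≠ 0) (hZ : ∑ l, z ^ c l * X l z ≠ 0) (i : ι)
    (hi : 1 - (1 - z) * (z ^ c i * X i z / ∑ l, z ^ c l * X l z) ≠ 0) :
    logDeriv (fun z => ∑ l, z ^ c l * X l z - (1 - z) * (z ^ c i * X i z)) z =
      leafLogDeriv z (fun l => z ^ c l * X l z / ∑ m, z ^ c m * X m z)
        (fun l => logDeriv (X l) z)
        (fun l => c l * z ^ (c l - 1) * X l z / ∑ m, z ^ c m * X m z) i := by
  set Z := ∑ l, z ^ c l * X l z with hZdef
  have h1 : ∀ l, HasDerivAt (fun z => z ^ c l * X l z)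
      (c l * z ^ (c l - 1) * X l z + z ^ c l * (X l z * logDeriv (X l) z)) z := by
    intro l
    have := (hasDerivAt_pow (c l) z).mul (hX l z).hasDerivAt
    refine this.congr_deriv ?_
    rw [logDeriv_apply, mul_div_cancel₀ _ (hX0 l)]
  have h2 := (HasDerivAt.fun_sum (u := Finset.univ) fun l _ => h1 l).sub
    (((hasDerivAt_id z).const_sub 1).mul (h1 i))
  have h3 : deriv (fun z => ∑ l, z ^ c l * X l z - (1 - z) * (z ^ c i * X i z)) z = _ := h2.deriv
  rw [logDeriv_apply, h3, leafLogDeriv, Finset.sum_add_distrib]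
  have e1 : ∑ l, z ^ c l * (X l z * logDeriv (X l) z) =
      Z * ∑ l, z ^ c l * X l z / Z * logDeriv (X l) z := by
    rw [Finset.mul_sum]
    refine Finset.sum_congr rfl fun l _ => ?_
    field_simp
  have e2 : ∑ l, c l * z ^ (c l - 1) * X l z = Z * ∑ l, c l * z ^ (c l - 1) * X l z / Z := by
    rw [Finset.mul_sum]
    refine Finset.sum_congr rfl fun l _ => ?_
    field_simp
  rw [e1, e2, ← hZdef]
  set ybar := ∑ l, z ^ c l * X l z / Z * logDeriv (X l) z
  set ebar := ∑ l, c l * z ^ (c l - 1) * X l z / Z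
  set yi := logDeriv (X i) z
  obtain ⟨P, hP⟩ : ∃ P, P = z ^ c i * X i z / Z := ⟨_, rfl⟩
  obtain ⟨Q, hQ⟩ : ∃ Q, Q = c i * z ^ (c i - 1) * X i z / Z := ⟨_, rfl⟩
  have hP' : z ^ c i * X i z = Z * P := by rw [hP]; field_simp
  have hQ' : c i * z ^ (c i - 1) * X i z = Z * Q := by rw [hQ]; field_simp
  have hP'' : z ^ c i * (X i z * yi) = Z * P * yi := by rw [← hP']; ring
  rw [← hP] at hi
  simp only [id]
  rw [← hP, ← hQ, hP'', hP', hQ']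
  have h5 : Z - (1 - z) * (Z * P) = Z * (1 - (1 - z) * P) := by ring
  obtain ⟨U, hU⟩ : ∃ U, U = 1 - (1 - z) * P := ⟨_, rfl⟩
  rw [h5, ← hU]
  rw [← hU] at hi
  field_simp
  rw [hU]
  ring

section Perturb

variable {p : ι → ℝ} {pz y e : ι → ℂ} {z : ℂ} {w ε σ M : ℝ} {Δ : ℕ}

theorem norm_sub_average_le (hsum : ∑ l, pz l = 1) (i : ι) :
    ‖y i - ∑ l, pz l * y l‖ ≤ ∑ l, ‖pz l‖ * ‖y i - y l‖ := by
  have : y i - ∑ l, pz l * y l = ∑ l, pz l * (y i - y l) := by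
    simp only [mul_sub, Finset.sum_sub_distrib, ← Finset.sum_mul, hsum, one_mul]
  rw [this]
  exact (norm_sum_le _ _).trans (by simp)

/-- The factor with which the perturbation of the color `i` at a neighbor is propagated. -/
noncomputable def gain (b p : ℝ) : ℝ := b * p / (1 - b * p)

/-- The real quantity `s0` is at most `1 / 3` and moves by at most `1 / 6`, so `‖1 - s‖ ≥ 1 / 2`.
The difference of the two quotients is `(s - s0) / ((1 - s) * (1 - s0))`, with a denominator of norm
at least `1 / 3`. -/
theorem gain_perturb (hw : w ∈ Set.Icc (0 : ℝ) 1) (hz : ‖z - w‖ ≤ ε) {P : ℝ} {Pz : ℂ}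
    (hP0 : 0 ≤ P) (hP : P ≤ 1 / 3) (hPz : ‖Pz - P‖ ≤ σ) (hσ : 2 * σ + ε ≤ 1 / 6) :
    1 / 2 ≤ ‖1 - (1 - z) * Pz‖ ∧
      ‖(1 - z) * Pz / (1 - (1 - z) * Pz) - (gain (1 - w) P : ℂ)‖ ≤ 3 * (2 * σ + ε) := by
  have hε0 : 0 ≤ ε := (norm_nonneg _).trans hz
  have hσ0 : 0 ≤ σ := (norm_nonneg _).trans hPz
  set s := (1 - z) * Pz with hs
  set s0 := (1 - w) * P with hs0
  have hs0n : 0 ≤ s0 := mul_nonneg (by linarith [hw.2]) hP0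
  have hs0l : s0 ≤ 1 / 3 := (mul_le_of_le_one_left hP0 (by linarith [hw.1])).trans hP
  have h1z : ‖1 - z‖ ≤ 2 := by
    have h1 : (1 : ℂ) - z = ((1 - w : ℝ) : ℂ) - (z - w) := by push_cast; ring
    rw [h1]
    refine (norm_sub_le _ _).trans ?_
    rw [Complex.norm_real, Real.norm_of_nonneg (by linarith [hw.2])]
    linarith [hw.1]
  have hd : ‖s - s0‖ ≤ 2 * σ + ε := by
    have : s - (s0 : ℂ) = (1 - z) * (Pz - P) - (z - w) * P := by
      rw [hs, hs0]; push_cast; ring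
    rw [this]
    refine (norm_sub_le _ _).trans (add_le_add ?_ ?_)
    · rw [norm_mul]
      exact mul_le_mul h1z hPz (norm_nonneg _) (by norm_num)
    · rw [norm_mul, Complex.norm_real, Real.norm_of_nonneg hP0]
      calc _ ≤ ε * 1 := mul_le_mul hz (by linarith) hP0 hε0
        _ = ε := mul_one _
  have h2 : 1 / 2 ≤ ‖1 - s‖ := by
    have : (((1 - s0 : ℝ)) : ℂ) = (1 - s) + (s - s0) := by push_cast; ring
    have h3 : ‖((1 - s0 : ℝ) : ℂ)‖ ≤ ‖1 - s‖ + ‖s - s0‖ := by rw [this]; exact norm_add_le _ _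
    rw [Complex.norm_real, Real.norm_of_nonneg (by linarith)] at h3
    linarith
  refine ⟨h2, ?_⟩
  have hn1 : (1 - s) ≠ 0 := norm_pos_iff.1 (by linarith)
  have hn2 : (1 - (s0 : ℂ)) ≠ 0 := by
    have : (1 - s0) ≠ 0 := by linarith
    exact_mod_cast this
  have : s / (1 - s) - (gain (1 - w) P : ℂ) = (s - s0) / ((1 - s) * (1 - s0)) := by
    rw [gain, ← hs0]
    push_cast
    field_simp
    ring
  rw [this, norm_div, norm_mul]
  have h3 : ‖1 - (s0 : ℂ)‖ = 1 - s0 := by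
    have : (1 - (s0 : ℂ)) = ((1 - s0 : ℝ) : ℂ) := by push_cast; ring
    rw [this, Complex.norm_real, Real.norm_of_nonneg (by linarith)]
  rw [h3, div_le_iff₀ (mul_pos (by linarith) (by linarith))]
  have : 1 / 3 ≤ ‖1 - s‖ * (1 - s0) := by nlinarith
  nlinarith

/-- Only the coefficients move to the real point `w`; the `y l` remain at `z`. This costs a small
multiple of `M`. The explicit terms cost `50 * Δ` per color, independently of `M`, so a large `M`
makes them negligible. -/
theorem norm_leafLogDeriv_sub_le (hw : w ∈ Set.Icc (0 : ℝ) 1) (hz : ‖z - w‖ ≤ ε)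
    (hsumz : ∑ l, pz l = 1) (hsum : ∑ l, p l = 1) (hp0 : ∀ l, 0 ≤ p l)
    (hp : ∀ l, p l ≤ 1 / 3) (hpz : ∑ l, ‖pz l - p l‖ ≤ σ) (hσ : 2 * σ + ε ≤ 1 / 6)
    (he : ∑ l, ‖e l‖ ≤ 8 * Δ) (hΔ : 3 ≤ Δ) (hM : ∀ l m, ‖y l - y m‖ ≤ M) (i j : ι) :
    ‖leafLogDeriv z pz y e i - leafLogDeriv z pz y e j‖ ≤
      ‖(gain (1 - w) (p i) : ℂ) * (y i - ∑ l, p l * y l) -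
        (gain (1 - w) (p j) : ℂ) * (y j - ∑ l, p l * y l)‖ +
      13 * (2 * σ + ε) * M + 100 * Δ := by
  have hε0 : 0 ≤ ε := (norm_nonneg _).trans hz
  have hσ0 : 0 ≤ σ := (Finset.sum_nonneg fun _ _ => norm_nonneg _).trans hpz
  have hM0 : 0 ≤ M := (norm_nonneg _).trans (hM i i)
  have hpl : ∀ l, ‖pz l - p l‖ ≤ σ := fun l =>
    (Finset.single_le_sum (fun l _ => norm_nonneg (pz l - p l)) (Finset.mem_univ l)).trans hpz
  have hel : ∀ l, ‖e l‖ ≤ 8 * Δ := fun l =>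
    (Finset.single_le_sum (fun l _ => norm_nonneg (e l)) (Finset.mem_univ l)).trans he
  have h1z : ‖1 - z‖ ≤ 2 := by
    have h1 : (1 : ℂ) - z = ((1 - w : ℝ) : ℂ) - (z - w) := by push_cast; ring
    rw [h1]
    refine (norm_sub_le _ _).trans ?_
    rw [Complex.norm_real, Real.norm_of_nonneg (by linarith [hw.2])]
    linarith [hw.1]
  set y₀ := ∑ l, p l * y l with hY
  set yz := ∑ l, pz l * y l with hYz
  have hyz : ∀ k, ‖y k - yz‖ ≤ 2 * M := by
    intro k
    refine (norm_sub_average_le hsumz k).trans ?_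
    calc ∑ l, ‖pz l‖ * ‖y k - y l‖ ≤ ∑ l, (‖pz l - p l‖ + p l) * M := by
          refine Finset.sum_le_sum fun l _ => mul_le_mul ?_ (hM k l) (norm_nonneg _)
            (add_nonneg (norm_nonneg _) (hp0 l))
          calc ‖pz l‖ = ‖(pz l - p l) + p l‖ := by ring_nf
            _ ≤ _ := (norm_add_le _ _).trans (by
              rw [Complex.norm_real, Real.norm_of_nonneg (hp0 l)])
      _ = (∑ l, ‖pz l - p l‖ + 1) * M := by
          rw [← Finset.sum_mul, Finset.sum_add_distrib, hsum]
      _ ≤ 2 * M := mul_le_mul_of_nonneg_right (by linarith) hM0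
  have hyy : ‖yz - y₀‖ ≤ σ * M := by
    have : yz - y₀ = ∑ l, (pz l - p l) * (y l - y i) := by
      simp only [mul_sub, Finset.sum_sub_distrib, sub_mul, ← Finset.sum_mul, hsumz]
      have : ∑ l, (p l : ℂ) = 1 := by exact_mod_cast hsum
      rw [this]
      ring
    rw [this]
    refine (norm_sum_le _ _).trans ?_
    calc ∑ l, ‖(pz l - p l) * (y l - y i)‖ ≤ ∑ l, ‖pz l - p l‖ * M := by
          refine Finset.sum_le_sum fun l _ => ?_
          rw [norm_mul]
          exact mul_le_mul_of_nonneg_left (hM l i) (norm_nonneg _)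
      _ ≤ σ * M := by
          rw [← Finset.sum_mul]; exact mul_le_mul_of_nonneg_right hpz hM0
  have hg : ∀ k, 0 ≤ gain (1 - w) (p k) ∧ gain (1 - w) (p k) ≤ 1 / 2 := by
    intro k
    have h1 : 0 ≤ (1 - w) * p k := mul_nonneg (by linarith [hw.2]) (hp0 k)
    have h2 : (1 - w) * p k ≤ 1 / 3 :=
      (mul_le_of_le_one_left (hp0 k) (by linarith [hw.1])).trans (hp k)
    refine ⟨div_nonneg h1 (by linarith), ?_⟩
    rw [gain, div_le_iff₀ (by linarith)]
    linarith
  have hmain : ∀ k, ‖(1 - z) * pz k / (1 - (1 - z) * pz k) * (y k - yz) -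
      (gain (1 - w) (p k) : ℂ) * (y k - y₀)‖ ≤ 6 * (2 * σ + ε) * M + 1 / 2 * (σ * M) := by
    intro k
    have h1 := (gain_perturb hw hz (hp0 k) (hp k) (hpl k) hσ).2
    have : (1 - z) * pz k / (1 - (1 - z) * pz k) * (y k - yz) -
        (gain (1 - w) (p k) : ℂ) * (y k - y₀) =
        ((1 - z) * pz k / (1 - (1 - z) * pz k) - (gain (1 - w) (p k) : ℂ)) * (y k - yz) -
        (gain (1 - w) (p k) : ℂ) * (yz - y₀) := by ring
    rw [this]
    refine (norm_sub_le _ _).trans (add_le_add ?_ ?_)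
    · rw [norm_mul]
      calc _ ≤ 3 * (2 * σ + ε) * (2 * M) :=
            mul_le_mul h1 (hyz k) (norm_nonneg _) (by positivity)
        _ = _ := by ring
    · rw [norm_mul, Complex.norm_real, Real.norm_of_nonneg (hg k).1]
      exact mul_le_mul (hg k).2 hyy (norm_nonneg _) (by norm_num)
  have hΔ' : (3 : ℝ) ≤ Δ := by exact_mod_cast hΔ
  have hexp : ∀ k, ‖(pz k + ∑ l, e l - (1 - z) * e k) / (1 - (1 - z) * pz k)‖ ≤ 50 * Δ := by
    intro k
    have h1 := (gain_perturb hw hz (hp0 k) (hp k) (hpl k) hσ).1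
    rw [norm_div, div_le_iff₀ (by linarith)]
    have h2 : ‖pz k‖ ≤ 1 := by
      calc ‖pz k‖ = ‖(pz k - p k) + p k‖ := by ring_nf
        _ ≤ ‖pz k - p k‖ + p k := (norm_add_le _ _).trans (by
            rw [Complex.norm_real, Real.norm_of_nonneg (hp0 k)])
        _ ≤ 1 := by linarith [hpl k, hp k]
    have h3 : ‖∑ l, e l‖ ≤ 8 * Δ := (norm_sum_le _ _).trans he
    have h4 : ‖(1 - z) * e k‖ ≤ 2 * (8 * Δ) := by
      rw [norm_mul]; exact mul_le_mul h1z (hel k) (norm_nonneg _) (by norm_num)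
    calc ‖pz k + ∑ l, e l - (1 - z) * e k‖ ≤ ‖pz k‖ + ‖∑ l, e l‖ + ‖(1 - z) * e k‖ :=
          (norm_sub_le _ _).trans (add_le_add (norm_add_le _ _) le_rfl)
      _ ≤ 50 * Δ * (1 / 2) := by linarith
      _ ≤ _ := mul_le_mul_of_nonneg_left h1 (by positivity)
  set Ai := (1 - z) * pz i / (1 - (1 - z) * pz i) * (y i - yz) with hAi
  set Aj := (1 - z) * pz j / (1 - (1 - z) * pz j) * (y j - yz) with hAj
  set Gi := (gain (1 - w) (p i) : ℂ) * (y i - y₀) with hGi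
  set Gj := (gain (1 - w) (p j) : ℂ) * (y j - y₀) with hGj
  set Xi := (pz i + ∑ l, e l - (1 - z) * e i) / (1 - (1 - z) * pz i) with hXi
  set Xj := (pz j + ∑ l, e l - (1 - z) * e j) / (1 - (1 - z) * pz j) with hXj
  have hdecomp : leafLogDeriv z pz y e i - leafLogDeriv z pz y e j =
      -(Gi - Gj) - (Ai - Gi) + (Aj - Gj) + Xi - Xj := by
    simp only [leafLogDeriv, ← hYz, hAi, hAj, hXi, hXj]
    ring
  rw [hdecomp]
  have h1 := hmain i
  have h2 := hmain j
  have h3 := hexp i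
  have h4 := hexp j
  have h5 : ‖-(Gi - Gj) - (Ai - Gi) + (Aj - Gj) + Xi - Xj‖ ≤
      ‖Gi - Gj‖ + ‖Ai - Gi‖ + ‖Aj - Gj‖ + ‖Xi‖ + ‖Xj‖ := by
    refine (norm_sub_le _ _).trans (add_le_add ?_ le_rfl)
    refine (norm_add_le _ _).trans (add_le_add ?_ le_rfl)
    refine (norm_add_le _ _).trans (add_le_add ?_ le_rfl)
    refine (norm_sub_le _ _).trans (add_le_add ?_ le_rfl)
    rw [norm_neg]
  have h6 : σ * M ≤ (2 * σ + ε) * M := mul_le_mul_of_nonneg_right (by linarith) hM0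
  linarith

end Perturb

end Potts

/-! ### Contraction in the real model. -/

namespace Potts

variable {ι : Type*} [Fintype ι]

/-- Splitting `a = b + (a - b)` cancels the average in the part with coefficient `b`. The
coefficients then add up to `a`, whereas separate estimates would give `a + b`. -/
theorem norm_gain_diff_le {p : ι → ℝ} {y : ι → ℂ} (hp0 : ∀ l, 0 ≤ p l) (hsum : ∑ l, p l = 1)
    {a b : ℝ} (hb : 0 ≤ b) (hab : b ≤ a) (i j : ι) :
    ‖(a : ℂ) * (y i - ∑ l, p l * y l) - (b : ℂ) * (y j - ∑ l, p l * y l)‖ ≤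
      b * ‖y i - y j‖ + (a - b) * ∑ l, p l * ‖y i - y l‖ := by
  set y₀ := ∑ l, p l * y l with hy
  have h1 : ‖y i - y₀‖ ≤ ∑ l, p l * ‖y i - y l‖ := by
    have := norm_sub_average_le (pz := fun l => (p l : ℂ)) (y := y)
      (by exact_mod_cast hsum) i
    simpa [Complex.norm_real, abs_of_nonneg (hp0 _)] using this
  have h2 : (a : ℂ) * (y i - y₀) - (b : ℂ) * (y j - y₀) =
      (b : ℂ) * (y i - y j) + ((a - b : ℝ) : ℂ) * (y i - y₀) := by push_cast; ring
  rw [h2]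
  refine (norm_add_le _ _).trans ?_
  rw [norm_mul, norm_mul, Complex.norm_real, Complex.norm_real, Real.norm_of_nonneg hb,
    Real.norm_of_nonneg (sub_nonneg.2 hab)]
  gcongr

theorem average_le {p x : ι → ℝ} (hp0 : ∀ l, 0 ≤ p l) (hsum : ∑ l, p l = 1) {B : ℝ}
    (hx : ∀ l, x l ≤ B) : ∑ l, p l * x l ≤ B := by
  calc ∑ l, p l * x l ≤ ∑ l, p l * B :=
        Finset.sum_le_sum fun l _ => mul_le_mul_of_nonneg_left (hx l) (hp0 l)
    _ = B := by rw [← Finset.sum_mul, hsum, one_mul]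

/-- The tangent of `log` at `2`, taken at `1 / x`. It serves as a linear form of Jensen's
inequality; at the threshold `q ≈ 2Δ` the average of `1 / W l` is at most about `q / (q - Δ) ≈ 2`.
-/
theorem neg_log_le_half {x : ℝ} (hx : 0 < x) :
    -Real.log x ≤ Real.log 2 - 1 + 1 / 2 * (1 / x) := by
  have h := Real.log_le_sub_one_of_pos (x := 1 / (2 * x)) (by positivity)
  rw [one_div, Real.log_inv, Real.log_mul (by norm_num) hx.ne'] at h
  have : (2 * x)⁻¹ = 1 / 2 * (1 / x) := by rw [mul_inv]; ring
  linarith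

section Contraction

variable {W θ : ι → ℝ} {y : ι → ℂ} {b M : ℝ} {Δ q : ℕ}

theorem gain_nonneg {b p : ℝ} (hb : b ∈ Set.Icc (0 : ℝ) 1) (hp : 0 ≤ p) (hp1 : p ≤ 1 / 3) :
    0 ≤ gain b p := by
  have h1 : 0 ≤ b * p := mul_nonneg hb.1 hp
  have h2 : b * p ≤ p := mul_le_of_le_one_left hp hb.2
  exact div_nonneg h1 (by linarith)

theorem gain_le {b p t : ℝ} (hb : b ∈ Set.Icc (0 : ℝ) 1) (hp : 0 ≤ p) (ht : 0 < t)
    (hpt : p * (t + 1) ≤ 1) : gain b p ≤ 1 / t := by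
  have h1 : 0 ≤ b * p := mul_nonneg hb.1 hp
  have h2 : b * p ≤ p := mul_le_of_le_one_left hp hb.2
  have h3 : b * p * (t + 1) ≤ 1 := (mul_le_mul_of_nonneg_right h2 (by linarith)).trans hpt
  have h4 : b * p < 1 := by nlinarith
  rw [gain, div_le_div_iff₀ (by linarith) ht]
  linarith

theorem lt_mul_of_lt_gain {b p x D : ℝ} (hb : b ∈ Set.Icc (0 : ℝ) 1) (hp : 0 ≤ p)
    (hp1 : p ≤ 1 / 3) (hx : 0 ≤ x) (hD : 0 < D) (h : x < D * gain b p) : x < p * (D + x) := by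
  have h1 : 0 ≤ b * p := mul_nonneg hb.1 hp
  have h2 : b * p ≤ p := mul_le_of_le_one_left hp hb.2
  rw [gain, ← mul_div_assoc, lt_div_iff₀ (by linarith)] at h
  have : b * p * (D + x) ≤ p * (D + x) := mul_le_mul_of_nonneg_right h2 (by linarith)
  linarith

/-- The contraction in the real model: the combined effect of all colors at one neighbor is less
than the fraction `1 / (Δ - 1)` of the perturbation. -/
theorem norm_gain_diff_le_contraction (hΔ : 3 ≤ Δ) (hq : 1.998 * (Δ : ℝ) ≤ q)
    (hcard : Fintype.card ι = q) (hb : b ∈ Set.Icc (0 : ℝ) 1)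
    (hW0 : ∀ l, 0 < W l) (hW1 : ∀ l, W l ≤ 1) (hθ0 : ∀ l, 0 ≤ θ l) (hθ1 : ∀ l, θ l ≤ 1)
    (hS : (q : ℝ) - (Δ - 1) ≤ ∑ l, θ l * W l)
    (hM : ∀ l m, ‖y l - y m‖ ≤ M)
    (hM2 : 500 ≤ Δ → ∀ l m,
      ‖y l - y m‖ ≤ M * (6.1 * (1 - W l) - 1.003 * Real.log (W m) + 0.0005))
    (i j : ι) (hij : gain b (θ j * W j / ∑ m, θ m * W m) ≤ gain b (θ i * W i / ∑ m, θ m * W m)) :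
    ‖(gain b (θ i * W i / ∑ m, θ m * W m) : ℂ) *
        (y i - ∑ l, ((θ l * W l / ∑ m, θ m * W m : ℝ) : ℂ) * y l) -
      (gain b (θ j * W j / ∑ m, θ m * W m) : ℂ) *
        (y j - ∑ l, ((θ l * W l / ∑ m, θ m * W m : ℝ) : ℂ) * y l)‖ ≤
      M * (1 / ((Δ : ℝ) - 1) - 0.0005 / Δ) := by
  have hΔ' : (3 : ℝ) ≤ Δ := by exact_mod_cast hΔ
  have hM0 : 0 ≤ M := (norm_nonneg _).trans (hM i i)
  set S := ∑ m, θ m * W m with hSdef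
  have hS0 : 0 < S := by linarith
  set p : ι → ℝ := fun l => θ l * W l / S with hpdef
  have hp0 : ∀ l, 0 ≤ p l := fun l => div_nonneg (mul_nonneg (hθ0 l) (hW0 l).le) hS0.le
  have hθW : ∀ l, θ l * W l ≤ W l := fun l => mul_le_of_le_one_left (hW0 l).le (hθ1 l)
  have hsum : ∑ l, p l = 1 := by
    rw [hpdef, ← Finset.sum_div, ← hSdef, div_self hS0.ne']
  set t := (q : ℝ) - Δ with ht
  have ht0 : 0 < t := by linarith
  have hpt : ∀ l, p l * (t + 1) ≤ 1 := by
    intro l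
    rw [hpdef]
    simp only
    rw [div_mul_eq_mul_div, div_le_one hS0]
    have h1 := (hθW l).trans (hW1 l)
    have : θ l * W l * (t + 1) ≤ 1 * (t + 1) := mul_le_mul_of_nonneg_right h1 (by linarith)
    linarith
  have hp3 : ∀ l, p l ≤ 1 / 3 := by
    intro l
    have h1 := hpt l
    have h2 : 3 ≤ t + 1 := by linarith
    have : p l * 3 ≤ p l * (t + 1) := mul_le_mul_of_nonneg_left h2 (hp0 l)
    linarith
  have hgj := gain_nonneg hb (hp0 j) (hp3 j)
  have hT := norm_gain_diff_le (y := y) hp0 hsum hgj hij i j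
  refine hT.trans ?_
  have hgi : gain b (p i) ≤ 1 / t := gain_le hb (hp0 i) ht0 (hpt i)
  change gain b (p j) ≤ gain b (p i) at hij
  change gain b (p j) * _ + (gain b (p i) - gain b (p j)) * _ ≤ _
  set a := gain b (p i) with ha
  set a' := gain b (p j) with ha'
  have hav : ∑ l, p l * ‖y i - y l‖ ≤ M := average_le hp0 hsum fun l => hM i l
  have hD : 0 < (Δ : ℝ) - 1 := by linarith
  have hsimple : a' * ‖y i - y j‖ + (a - a') * ∑ l, p l * ‖y i - y l‖ ≤ a * M := by
    have h1 : a' * ‖y i - y j‖ ≤ a' * M := mul_le_mul_of_nonneg_left (hM i j) hgj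
    have h2 := mul_le_mul_of_nonneg_left hav (sub_nonneg.2 hij)
    linarith
  rcases lt_or_ge Δ 500 with hsmall | hlarge
  · have hq2 : (2 : ℝ) * Δ ≤ q := by
      have h1 : (Δ : ℝ) < 500 := by exact_mod_cast hsmall
      have h2 : ((2 * Δ : ℕ) : ℝ) < ((q + 1 : ℕ) : ℝ) := by push_cast; linarith
      have h3 : 2 * Δ < q + 1 := by exact_mod_cast h2
      have h4 : 2 * Δ ≤ q := by omega
      exact_mod_cast h4
    refine hsimple.trans ?_
    rw [mul_comm]
    refine mul_le_mul_of_nonneg_left (hgi.trans ?_) hM0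
    have h1 : 1 / t ≤ 1 / Δ := one_div_le_one_div_of_le (by linarith) (by linarith)
    have h2 : (Δ : ℝ) < 500 := by exact_mod_cast hsmall
    refine h1.trans ?_
    rw [le_sub_iff_add_le, ← add_div, div_le_div_iff₀ (by linarith) hD]
    linarith
  · have hΔ5 : (500 : ℝ) ≤ Δ := by exact_mod_cast hlarge
    set D := (Δ : ℝ) - 1 with hDdef
    have hgoal : D * (a' * ‖y i - y j‖ + (a - a') * ∑ l, p l * ‖y i - y l‖) ≤ 0.999 * M →
        a' * ‖y i - y j‖ + (a - a') * ∑ l, p l * ‖y i - y l‖ ≤ M * (1 / D - 0.0005 / Δ) := by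
      intro h
      have h1 : 0.999 / D ≤ 1 / D - 0.0005 / Δ := by
        rw [le_sub_iff_add_le, div_add_div _ _ hD.ne' (by linarith), div_le_div_iff₀
          (by positivity) hD]
        nlinarith
      calc _ = D * (a' * ‖y i - y j‖ + (a - a') * ∑ l, p l * ‖y i - y l‖) / D := by
            field_simp
        _ ≤ 0.999 * M / D := div_le_div_of_nonneg_right h hD.le
        _ = M * (0.999 / D) := by ring
        _ ≤ _ := mul_le_mul_of_nonneg_left h1 hM0
    apply hgoal
    have hSD : 0.998 * (D + 1) ≤ S := by
      have : 1.998 * (D + 1) ≤ q := by rw [hDdef]; linarith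
      linarith
    -- Below `0.99` the crude bound suffices. Above it `W i ≥ 0.998 * 0.99`, and `6.1 * (1 - W i) +
    -- 0.0005` is at most `0.0738`.
    rcases le_or_gt (D * a) 0.99 with hs | hs
    · have := mul_le_mul_of_nonneg_left hsimple hD.le
      have : D * a * M ≤ 0.99 * M := mul_le_mul_of_nonneg_right hs hM0
      linarith
    have hDt : D * a ≤ 1.0021 := by
      have : D * a ≤ D * (1 / t) := mul_le_mul_of_nonneg_left hgi hD.le
      refine this.trans ?_
      rw [mul_one_div, div_le_iff₀ ht0]
      linarith
    have hWlow : ∀ l x, 0 ≤ x → x ≤ 1 → x < D * gain b (p l) → 0.998 * x ≤ W l := by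
      intro l x hx0 hx1 hx
      have h1 := lt_mul_of_lt_gain hb (hp0 l) (hp3 l) hx0 hD hx
      have h2 : p l * S = θ l * W l := by
        rw [hpdef]; field_simp
      have h3 : 0.998 * (D + x) ≤ S := by linarith
      have h4 : p l * (0.998 * (D + x)) ≤ p l * S := mul_le_mul_of_nonneg_left h3 (hp0 l)
      have := hθW l
      linarith
    have hWi := hWlow i 0.99 (by norm_num) (by norm_num) hs
    have hlog2 : Real.log 2 < 0.6932 := Real.log_two_lt_d9.trans (by norm_num)
    have hB : ∀ l, ‖y i - y l‖ ≤ M * (0.0738 - 1.003 * Real.log (W l)) := by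
      intro l
      refine (hM2 hlarge i l).trans (mul_le_mul_of_nonneg_left ?_ hM0)
      linarith
    -- The `1 / W l` of the tangent bound cancels the `W l` in `p l`, leaving `(∑ θ) / S ≤ 2.0021`;
    -- the constants then add up to about `0.771`.
    have hav2 : ∑ l, p l * ‖y i - y l‖ ≤ M * 0.78 := by
      have h1 : ∀ l, p l * ‖y i - y l‖ ≤
          M * ((0.0738 + 1.003 * (Real.log 2 - 1)) * p l + 1.003 / 2 * (θ l / S)) := by
        intro l
        have h2 : p l * ‖y i - y l‖ ≤
            p l * (M * (0.0738 + 1.003 * (Real.log 2 - 1 + 1 / 2 * (1 / W l)))) := by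
          refine mul_le_mul_of_nonneg_left ((hB l).trans (mul_le_mul_of_nonneg_left ?_ hM0))
            (hp0 l)
          linarith [neg_log_le_half (hW0 l)]
        refine h2.trans (le_of_eq ?_)
        have h3 : p l * (1 / W l) = θ l / S := by
          rw [hpdef]
          have := (hW0 l).ne'
          field_simp
        calc _ = M * ((0.0738 + 1.003 * (Real.log 2 - 1)) * p l +
              1.003 / 2 * (p l * (1 / W l))) := by ring
          _ = _ := by rw [h3]
      refine (Finset.sum_le_sum fun l _ => h1 l).trans ?_
      rw [← Finset.mul_sum, Finset.sum_add_distrib, ← Finset.mul_sum, ← Finset.mul_sum, hsum,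
        ← Finset.sum_div]
      refine mul_le_mul_of_nonneg_left ?_ hM0
      have h2 : (∑ l, θ l) / S ≤ 2.0021 := by
        have h3 : ∑ l, θ l ≤ q := by
          calc ∑ l, θ l ≤ ∑ l : ι, (1 : ℝ) := Finset.sum_le_sum fun l _ => hθ1 l
            _ = q := by simp [hcard]
        rw [div_le_iff₀ hS0]
        linarith
      linarith
    -- For `D * a' ≤ 0.5` the crude bound exceeds the target `0.78` by at most `0.22 * 0.5 = 0.11`.
    -- Otherwise `W j` is at least `0.499`, and the pointwise bound gives `0.78` too.
    have haj : D * a' * ‖y i - y j‖ ≤ 0.78 * M * (D * a') + 0.11 * M := by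
      rcases le_or_gt (D * a') 0.5 with hs' | hs'
      · have h0 : 0 ≤ D * a' := mul_nonneg hD.le hgj
        have h1 : D * a' * ‖y i - y j‖ ≤ D * a' * M := mul_le_mul_of_nonneg_left (hM i j) h0
        have h2 : D * a' * M ≤ 0.5 * M := mul_le_mul_of_nonneg_right hs' hM0
        nlinarith
      · have hWj := hWlow j 0.5 (by norm_num) (by norm_num) hs'
        have h1 : 1 / W j ≤ 2.005 := by
          rw [div_le_iff₀ (hW0 j)]; linarith
        have h2 : ‖y i - y j‖ ≤ M * 0.78 := by
          refine (hB j).trans (mul_le_mul_of_nonneg_left ?_ hM0)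
          linarith [neg_log_le_half (hW0 j)]
        have h0 : 0 ≤ D * a' := mul_nonneg hD.le hgj
        have := mul_le_mul_of_nonneg_left h2 h0
        linarith
    have h1 : D * (a - a') * ∑ l, p l * ‖y i - y l‖ ≤ D * (a - a') * (M * 0.78) :=
      mul_le_mul_of_nonneg_left hav2 (mul_nonneg hD.le (sub_nonneg.2 hij))
    have h2 : D * a * M ≤ 1.0021 * M := mul_le_mul_of_nonneg_right hDt hM0
    calc D * (a' * ‖y i - y j‖ + (a - a') * ∑ l, p l * ‖y i - y l‖) =
          D * a' * ‖y i - y j‖ + D * (a - a') * ∑ l, p l * ‖y i - y l‖ := by ring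
      _ ≤ 0.78 * M * (D * a') + 0.11 * M + D * (a - a') * (M * 0.78) := add_le_add haj h1
      _ = 0.78 * (D * a * M) + 0.11 * M := by ring
      _ ≤ 0.999 * M := by linarith

end Contraction

end Potts

/-! ### The induction statement and the passage from one neighbor to all. -/

namespace Potts

variable {V : Type*} [Fintype V] [DecidableEq V] {q : ℕ}

/-- The induction statement for the active set `A`: zero-freeness, and a bound on the influence of
the color of one leaf, both uniformly and in terms of the model at the real parameter `w`. -/
structure Stable (Ψ : Finset (V → Fin q)) (Δ : ℕ) (w ε M : ℝ) (A : Finset V) : Prop where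
  ne_zero : ∀ E c, Adm Δ A E c → ∀ z ∈ Metric.ball (w : ℂ) ε, pf Ψ E c z ≠ 0
  leaf : ∀ E c, Adm Δ A E c → ∀ u ∈ A, (nbr E u).card + ∑ l, c u l + 1 ≤ Δ → ∀ i j : Fin q,
    ∀ z ∈ Metric.ball (w : ℂ) ε,
      ‖logDeriv (fun z => pf Ψ E (attach c {u} fun _ => i) z) z -
        logDeriv (fun z => pf Ψ E (attach c {u} fun _ => j) z) z‖ ≤ M * (1 / ((Δ : ℝ) - 1)) ∧
      ‖logDeriv (fun z => pf Ψ E (attach c {u} fun _ => i) z) z -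
        logDeriv (fun z => pf Ψ E (attach c {u} fun _ => j) z) z‖ ≤
          M * ((pf Ψ E c w / pf Ψ E (attach c {u} fun _ => i) w - 1) +
            (pf Ψ E c w / pf Ψ E (attach c {u} fun _ => j) w - 1) + 0.0005 / Δ)

/-- Values from index `N.card` on are never used; `v` is only a default there. -/
theorem exists_enumeration (N : Finset V) (v : V) : ∃ e : ℕ → V, (∀ k < N.card, e k ∈ N) ∧
    (∀ k < N.card, ∀ m < N.card, e k = e m → k = m) ∧ ∀ x ∈ N, ∃ k < N.card, e k = x := by
  refine ⟨fun k => if h : k < N.card then (N.equivFin.symm ⟨k, h⟩ : V) else v, ?_, ?_, ?_⟩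
  · intro k hk
    simp [hk]
  · intro k hk m hm h
    simpa [hk, hm, Subtype.ext_iff] using h
  · intro x hx
    refine ⟨N.equivFin ⟨x, hx⟩, (N.equivFin ⟨x, hx⟩).2, ?_⟩
    simp

theorem attach_congr (c : V → Fin q → ℕ) {X : Finset V} {κ κ' : V → Fin q}
    (h : ∀ x ∈ X, κ x = κ' x) : attach c X κ = attach c X κ' := by
  funext x l
  by_cases hx : x ∈ X
  · simp [attach, h x hx]
  · simp [attach, hx]

theorem agree_mono {X Y : Finset V} (hXY : X ⊆ Y) {κ κ' : V → Fin q}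
    (h : ∀ x ∈ X, κ x = κ' x) (ψ : V → Fin q) : agree X κ ψ ≤ agree Y κ' ψ := by
  refine Finset.card_le_card fun x hx => ?_
  obtain ⟨h1, h2⟩ := Finset.mem_filter.1 hx
  exact Finset.mem_filter.2 ⟨hXY h1, (h x h1) ▸ h2⟩

theorem pf_attach_attach_singleton {R : Type*} [CommSemiring R] (Ψ : Finset (V → Fin q))
    (E : Finset (Sym2 V)) (c : V → Fin q → ℕ) (X : Finset V) (κ : V → Fin q) (u : V) (i : Fin q)
    (z : R) : pf Ψ E (attach (attach c X κ) {u} fun _ => i) z =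
      ∑ ψ ∈ Ψ, z ^ expo E c ψ * (z ^ agree X κ ψ * z ^ agree {u} (fun _ => i) ψ) := by
  simp only [pf_attach, expo_attach, pow_add, mul_assoc]

/-- A leaf at `u` has more effect in the presence of fewer other leaves. -/
theorem pf_attach_sub_le {w : ℝ} (hw : w ∈ Set.Icc (0 : ℝ) 1) (Ψ : Finset (V → Fin q))
    (E : Finset (Sym2 V)) (c : V → Fin q → ℕ) {X Y : Finset V} (hXY : X ⊆ Y) {κ κ' : V → Fin q}
    (h : ∀ x ∈ X, κ x = κ' x) (u : V) (i : Fin q) :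
    pf Ψ E (attach c Y κ') w - pf Ψ E (attach (attach c Y κ') {u} fun _ => i) w ≤
      pf Ψ E (attach c X κ) w - pf Ψ E (attach (attach c X κ) {u} fun _ => i) w := by
  rw [pf_attach_attach_singleton, pf_attach_attach_singleton, pf_attach, pf_attach,
    ← Finset.sum_sub_distrib, ← Finset.sum_sub_distrib]
  refine Finset.sum_le_sum fun ψ _ => ?_
  rw [← mul_sub, ← mul_sub]
  refine mul_le_mul_of_nonneg_left ?_ (pow_nonneg hw.1 _)
  have h1 : w ^ agree Y κ' ψ ≤ w ^ agree X κ ψ :=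
    pow_le_pow_of_le_one hw.1 hw.2 (agree_mono hXY h ψ)
  have h2 : w ^ agree {u} (fun _ => i) ψ ≤ 1 := pow_le_one₀ hw.1 hw.2
  nlinarith

section Star

variable {Ψ : Finset (V → Fin q)} {Δ : ℕ} {w ε M : ℝ} {A : Finset V} {E : Finset (Sym2 V)}
  {c : V → Fin q → ℕ}

/-- The color at the neighbors of a vertex is switched from `j` to `i` one by one. -/
theorem Stable.exists_telescope (hw : w ∈ Set.Icc (0 : ℝ) 1) (hq : Δ < q) (hΨ : Ψ.Nonempty)
    (hA : ∀ u ∈ A, ClosedAt Ψ u) (h : Adm Δ A E c) {v : V}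
    (hst : Stable Ψ Δ w ε M (A.erase v)) (i j : Fin q) :
    ∃ f m g : ℕ → ℝ, (∀ k, 0 < f k) ∧
      (∀ k, g 0 ≤ (1 + ((q : ℝ) - Δ)⁻¹) ^ (nbr E v).card * f k) ∧
      g 0 = pf Ψ (del E v) (Function.update c v 0) w ∧
      g (nbr E v).card = f (nbr E v).card ∧
      f (nbr E v).card =
        pf Ψ (del E v) (attach (Function.update c v 0) (nbr E v) fun _ => i) w ∧
      f 0 = pf Ψ (del E v) (attach (Function.update c v 0) (nbr E v) fun _ => j) w ∧
      (∀ k < (nbr E v).card, f (k + 1) ≤ m k) ∧ (∀ k < (nbr E v).card, f k ≤ m k) ∧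
      (∀ k < (nbr E v).card, m k ≤ (1 + ((q : ℝ) - Δ)⁻¹) * f k) ∧
      (∀ k < (nbr E v).card, m k - f (k + 1) ≤ g k - g (k + 1)) ∧
      ∀ z ∈ Metric.ball (w : ℂ) ε,
        ‖logDeriv (fun z => pf Ψ (del E v)
            (attach (Function.update c v 0) (nbr E v) fun _ => i) z) z -
          logDeriv (fun z => pf Ψ (del E v)
            (attach (Function.update c v 0) (nbr E v) fun _ => j) z) z‖ ≤
          (nbr E v).card * (M * (1 / ((Δ : ℝ) - 1))) ∧
        ‖logDeriv (fun z => pf Ψ (del E v)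
            (attach (Function.update c v 0) (nbr E v) fun _ => i) z) z -
          logDeriv (fun z => pf Ψ (del E v)
            (attach (Function.update c v 0) (nbr E v) fun _ => j) z) z‖ ≤
          ∑ k ∈ Finset.range (nbr E v).card,
            M * ((m k / f (k + 1) - 1) + (m k / f k - 1) + 0.0005 / Δ) := by
  obtain ⟨e, heN, hinj, hsurj⟩ := exists_enumeration (nbr E v) v
  set N := nbr E v with hN
  set c₀ := Function.update c v 0 with hc₀
  set d := N.card with hd
  have hA' : ∀ u ∈ A.erase v, ClosedAt Ψ u := fun u hu => hA u (Finset.mem_of_mem_erase hu)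
  let X : ℕ → Finset V := fun k => (Finset.range k).image e
  let κ : ℕ → V → Fin q := fun k x => if x ∈ X k then i else j
  have hXs : ∀ k, X (k + 1) = insert (e k) (X k) := by
    intro k; simp [X, Finset.range_add_one, Finset.image_insert]
  have hXN : ∀ k ≤ d, X k ⊆ N := by
    intro k hk x hx
    obtain ⟨m, hm, rfl⟩ := Finset.mem_image.1 hx
    exact heN m ((Finset.mem_range.1 hm).trans_le hk)
  have hXe : ∀ k < d, e k ∉ X k := by
    intro k hk hx
    obtain ⟨m, hm, hme⟩ := Finset.mem_image.1 hx
    have hm := Finset.mem_range.1 hm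
    have := hinj m (hm.trans hk) k hk hme
    omega
  have hXd : X d = N := by
    refine (hXN d le_rfl).antisymm fun x hx => ?_
    obtain ⟨k, hk, rfl⟩ := hsurj x hx
    exact Finset.mem_image_of_mem e (Finset.mem_range.2 hk)
  -- Hybrids: `F k` has color `i` on `X k` and `j` on the other neighbors, and `G k` omits the leaf
  -- at `e k`. Both `F k` and `F (k + 1)` are `G k` plus one leaf, and `e k` has degree below `Δ` in
  -- `G k`, so the induction hypothesis applies.
  let F : ℕ → V → Fin q → ℕ := fun k => attach c₀ N (κ k)
  let G : ℕ → V → Fin q → ℕ := fun k => attach c₀ (N.erase (e k)) (κ k)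
  have hGi : ∀ k < d, attach (G k) {e k} (fun _ => i) = F (k + 1) := by
    intro k hk
    refine attach_attach_erase c₀ (heN k hk) i (fun x _ hx => ?_) ?_
    · simp [κ, hXs, hx]
    · simp [κ, hXs]
  have hGj : ∀ k < d, attach (G k) {e k} (fun _ => j) = F k := by
    intro k hk
    refine attach_attach_erase c₀ (heN k hk) j (fun x _ hx => rfl) ?_
    simp [κ, hXe k hk]
  have hF0 : F 0 = attach c₀ N fun _ => j := attach_congr c₀ fun x _ => by simp [κ, X]
  have hFd : F d = attach c₀ N fun _ => i :=
    attach_congr c₀ fun x hx => by simp [κ, hXd, hx]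
  have hFadm : ∀ k, Adm Δ (A.erase v) (del E v) (F k) := fun k => h.del v subset_rfl _
  have hGadm : ∀ k, Adm Δ (A.erase v) (del E v) (G k) := fun k =>
    h.del v (Finset.erase_subset _ _) _
  have hGdeg : ∀ k < d, (nbr (del E v) (e k)).card + ∑ l, G k (e k) l + 1 ≤ Δ := fun k hk =>
    h.degree_del_lt (heN k hk) (Finset.notMem_erase _ _) _
  have heA : ∀ k < d, e k ∈ A.erase v := by
    intro k hk
    refine Finset.mem_erase.2 ⟨?_, h.supp _ (mem_nbr.1 (heN k hk)) _ (by simp)⟩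
    intro hev
    have := heN k hk
    rw [hev] at this
    exact not_mem_nbr_self h.loopless _ this
  have hleaf := fun k (hk : k < d) => hst.leaf _ _ (hGadm k) (e k) (heA k hk) (hGdeg k hk) i j
  have htel : ∀ z : ℂ, logDeriv (fun z => pf Ψ (del E v) (attach c₀ N fun _ => i) z) z -
      logDeriv (fun z => pf Ψ (del E v) (attach c₀ N fun _ => j) z) z =
      ∑ k ∈ Finset.range d, (logDeriv (fun z => pf Ψ (del E v) (F (k + 1)) z) z -
        logDeriv (fun z => pf Ψ (del E v) (F k) z) z) := by
    intro z
    rw [Finset.sum_range_sub fun k => logDeriv (fun z => pf Ψ (del E v) (F k) z) z, hFd, hF0]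
  refine ⟨fun k => pf Ψ (del E v) (F k) w, fun k => pf Ψ (del E v) (G k) w,
    fun k => pf Ψ (del E v) (attach c₀ (X k) fun _ => i) w, ?_, ?_, ?_, ?_, ?_, ?_, ?_, ?_, ?_, ?_,
    ?_⟩
  · exact fun k => pf_pos hw hΨ hq _ hA' _ _ (hFadm k)
  · intro k
    have : X 0 = ∅ := by simp [X]
    simp only [this, attach_empty]
    exact pf_le_pow_mul_pf_attach hw hq hA h (κ k) N subset_rfl
  · have : X 0 = ∅ := by simp [X]
    simp only [this, attach_empty]
  · simp only [hXd, hFd]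
  · simp only [hFd]
  · simp only [hF0]
  · intro k hk
    simp only [← hGi k hk]
    exact pf_attach_le hw _ _
  · intro k hk
    simp only [← hGj k hk]
    exact pf_attach_le hw _ _
  · intro k hk
    simp only [← hGj k hk]
    exact pf_le_mul_pf_attach_singleton hw hq (hA' _ (heA k hk)) (hGadm k).loopless
      (hGdeg k hk) j
  · intro k hk
    -- `G k` contains all leaves of `X k`, so the leaf at `e k` has at most the effect that it has
    -- next to those alone.
    have h1 := pf_attach_sub_le hw Ψ (del E v) c₀ (X := X k) (Y := N.erase (e k))
      (κ := fun _ => i) (κ' := κ k)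
      (fun x hx => Finset.mem_erase.2 ⟨fun hxe => hXe k hk (hxe ▸ hx), hXN k hk.le hx⟩)
      (fun x hx => by simp [κ, hx]) (e k) i
    have h2 : attach (attach c₀ (X k) fun _ => i) {e k} (fun _ => i) =
        attach c₀ (X (k + 1)) fun _ => i := by
      have := attach_attach_erase c₀ (X := X (k + 1)) (u := e k) (by simp [hXs])
        (κ := fun _ => i) (κ' := fun _ => i) i (fun _ _ _ => rfl) rfl
      rwa [hXs, Finset.erase_insert (hXe k hk), ← hXs] at this
    rw [h2] at h1
    change _ - pf Ψ (del E v) (attach (G k) _ _) w ≤ _ at h1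
    rw [hGi k hk] at h1
    exact h1
  · intro z hz
    rw [htel z]
    constructor
    · refine (norm_sum_le _ _).trans ?_
      rw [← nsmul_eq_mul]
      refine (Finset.sum_le_card_nsmul _ _ _ fun k hk => ?_).trans_eq (by rw [Finset.card_range])
      have hk := Finset.mem_range.1 hk
      have := (hleaf k hk z hz).1
      rwa [hGi k hk, hGj k hk] at this
    · refine (norm_sum_le _ _).trans (Finset.sum_le_sum fun k hk => ?_)
      have hk := Finset.mem_range.1 hk
      have := (hleaf k hk z hz).2
      rwa [hGi k hk, hGj k hk] at this

theorem one_add_inv_pow_le_three {t : ℝ} (ht : 0 < t) {n : ℕ} (hn : (n : ℝ) ≤ 1.0021 * t) :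
    (1 + t⁻¹) ^ n ≤ 3 := by
  have h1 : (1 + t⁻¹) ^ n ≤ Real.exp t⁻¹ ^ n :=
    pow_le_pow_left₀ (by positivity) (by linarith [Real.add_one_le_exp t⁻¹]) _
  rw [← Real.exp_nat_mul] at h1
  refine h1.trans ?_
  have h2 : (n : ℝ) * t⁻¹ ≤ 1 + 0.0021 := by
    rw [← div_eq_mul_inv, div_le_iff₀ ht]; linarith
  refine (Real.exp_le_exp.2 h2).trans ?_
  rw [Real.exp_add]
  have h3 := Real.exp_one_lt_d9
  have h4 : Real.exp 0.0021 * (1 - 0.0021) ≤ 1 := by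
    have := Real.add_one_le_exp (-0.0021)
    calc _ ≤ Real.exp 0.0021 * Real.exp (-0.0021) :=
          mul_le_mul_of_nonneg_left (by linarith) (Real.exp_pos _).le
      _ = 1 := by rw [← Real.exp_add]; norm_num
  have h5 : Real.exp 0.0021 ≤ 1.003 := by linarith
  calc _ ≤ 2.7182818286 * 1.003 := mul_le_mul h3.le h5 (Real.exp_pos _).le (by norm_num)
    _ ≤ 3 := by norm_num

/-- The bounds on the effect of the color of a vertex. -/
theorem Stable.vertex (hw : w ∈ Set.Icc (0 : ℝ) 1) (hΔ : 3 ≤ Δ) (hq : 1.998 * (Δ : ℝ) ≤ q)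
    (hΨ : Ψ.Nonempty) (hM : 0 ≤ M)
    (hA : ∀ u ∈ A, ClosedAt Ψ u) (h : Adm Δ A E c) {v : V}
    (hst : Stable Ψ Δ w ε M (A.erase v)) (i j : Fin q) {z : ℂ} (hz : z ∈ Metric.ball (w : ℂ) ε) :
    ‖logDeriv (fun z => pf Ψ (del E v)
        (attach (Function.update c v 0) (nbr E v) fun _ => i) z) z -
      logDeriv (fun z => pf Ψ (del E v)
        (attach (Function.update c v 0) (nbr E v) fun _ => j) z) z‖ ≤
      (nbr E v).card * (M * (1 / ((Δ : ℝ) - 1))) ∧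
    ((nbr E v).card + 1 ≤ Δ → 500 ≤ Δ →
      ‖logDeriv (fun z => pf Ψ (del E v)
          (attach (Function.update c v 0) (nbr E v) fun _ => i) z) z -
        logDeriv (fun z => pf Ψ (del E v)
          (attach (Function.update c v 0) (nbr E v) fun _ => j) z) z‖ ≤
        M * (6.1 * (1 - pf Ψ (del E v) (attach (Function.update c v 0) (nbr E v) fun _ => i) w /
            pf Ψ (del E v) (Function.update c v 0) w) -
          1.003 * Real.log (pf Ψ (del E v)
            (attach (Function.update c v 0) (nbr E v) fun _ => j) w /
              pf Ψ (del E v) (Function.update c v 0) w) + 0.0005)) := by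
  have hΔ' : (3 : ℝ) ≤ Δ := by exact_mod_cast hΔ
  have hqΔ : Δ < q := by
    have : (Δ : ℝ) < q := by linarith
    exact_mod_cast this
  obtain ⟨f, m, g, hf, hf', hg0, hgd, hfd, hf0, h1, h2, h3, h4, hbd⟩ :=
    hst.exists_telescope hw hqΔ hΨ hA h i j
  refine ⟨(hbd z hz).1, fun hd hΔ5 => (hbd z hz).2.trans ?_⟩
  have hle : ∀ l, pf Ψ (del E v) (attach (Function.update c v 0) (nbr E v) fun _ => l) w ≤
      pf Ψ (del E v) (Function.update c v 0) w := fun l => pf_attach_le hw _ _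
  have hi := hle i
  have hj := hle j
  rw [← hf0, ← hg0] at hj
  rw [← hfd, ← hg0] at hi
  rw [← hfd, ← hf0, ← hg0]
  set d := (nbr E v).card
  have hΔ5' : (500 : ℝ) ≤ Δ := by exact_mod_cast hΔ5
  set t := (q : ℝ) - Δ with ht
  have ht0 : 0 < t := by linarith
  have hdΔ : (d : ℝ) + 1 ≤ Δ := by exact_mod_cast hd
  have hpow : (1 + t⁻¹) ^ d ≤ 3 := one_add_inv_pow_le_three ht0 (by linarith)
  have hsum := sum_ratio_sub_one_le hf
    (fun k _ => (hf' k).trans (mul_le_mul_of_nonneg_right hpow (hf k).le)) hgd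
    (hgd ▸ hi) h1 h2 h3 h4
  rw [← Finset.mul_sum]
  refine mul_le_mul_of_nonneg_left ?_ hM
  rw [Finset.sum_add_distrib]
  have hg : 0 < g 0 := (hf 0).trans_le hj
  have ht1 : t⁻¹ ≤ 0.003 := by
    rw [inv_le_comm₀ ht0 (by norm_num)]
    norm_num
    linarith
  have hWi : f d / g 0 ≤ 1 := (div_le_one hg).2 hi
  have hlog : Real.log (f 0 / g 0) ≤ 0 :=
    Real.log_nonpos (div_nonneg (hf 0).le hg.le) ((div_le_one hg).2 hj)
  have hti : 0 < t⁻¹ := inv_pos.2 ht0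
  have hconst : ∑ k ∈ Finset.range d, (0.0005 / (Δ : ℝ)) ≤ 0.0005 := by
    rw [Finset.sum_const, Finset.card_range, nsmul_eq_mul, ← mul_div_assoc,
      div_le_iff₀ (by linarith)]
    linarith
  -- With `r = 1 + t⁻¹ ≤ 1.003` the first constant is `3 * (1 + r) ≤ 6.009`.
  nlinarith

end Star

end Potts

/-! ### The inductive step. -/

namespace Potts

variable {V : Type*} [Fintype V] [DecidableEq V] {q : ℕ}
  {Ψ : Finset (V → Fin q)} {Δ : ℕ} {w ε M : ℝ} {A : Finset V} {E : Finset (Sym2 V)}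
  {c : V → Fin q → ℕ}

/-- Functions with nearly equal logarithmic derivatives keep their proportions near `w`. -/
theorem exists_common_factor {ι : Type*} [Nonempty ι] {X : ι → ℂ → ℂ}
    (hX : ∀ l, Differentiable ℂ (X l))
    {x : ι → ℝ} (hx : ∀ l, 0 < x l) {x₀ : ℝ} (hx₀ : 0 < x₀) (hXw : ∀ l, X l w = x l)
    (hX0 : ∀ l, ∀ z ∈ Metric.ball (w : ℂ) ε, X l z ≠ 0)
    (hM : ∀ l m, ∀ z ∈ Metric.ball (w : ℂ) ε, ‖logDeriv (X l) z - logDeriv (X m) z‖ ≤ 2 * M)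
    (hMε : 2 * M * ε ≤ 1) {z : ℂ} (hz : z ∈ Metric.ball (w : ℂ) ε) :
    ∃ (K : ℂ) (ρ : ι → ℂ), K ≠ 0 ∧ (∀ l, ‖ρ l - 1‖ ≤ 4 * M * ε) ∧
      ∀ l, X l z = K * ((x l / x₀ : ℝ) * ρ l) := by
  have r : ι := Classical.arbitrary ι
  have hM0 : 0 ≤ 2 * M := (norm_nonneg _).trans (hM r r z hz)
  have hzε : ‖z - w‖ ≤ ε := (mem_ball_iff_norm.1 hz).le
  choose s hs hs' using fun l =>
    exists_exp_of_logDeriv_sub_le (hX l) (hX r) (hX0 l) (hX0 r) (hM l r) hz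
  have hrc : (x r : ℂ) ≠ 0 := by exact_mod_cast (hx r).ne'
  have h0c : (x₀ : ℂ) ≠ 0 := by exact_mod_cast hx₀.ne'
  -- All colors are compared with an arbitrary reference color `r`; `‖exp s - 1‖ ≤ 2 * ‖s‖` for `‖s‖
  -- ≤ 1` yields `4 * M * ε`.
  refine ⟨X r z * (x₀ / x r), fun l => Complex.exp (s l), ?_, ?_, ?_⟩
  · exact mul_ne_zero (hX0 r z hz) (div_ne_zero h0c hrc)
  · intro l
    have h1 : ‖s l‖ ≤ 2 * M * ε := (hs l).trans (mul_le_mul_of_nonneg_left hzε hM0)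
    have h2 := Complex.norm_exp_sub_one_le (h1.trans hMε)
    linarith
  · intro l
    have h1 := hs' l
    rw [hXw, hXw, div_eq_iff (hX0 r z hz)] at h1
    rw [h1]
    push_cast
    field_simp

/-- The smallness conditions on the parameters. -/
structure Params (Δ q : ℕ) (ε M : ℝ) : Prop where
  three_le : 3 ≤ Δ
  le_q : 1.998 * (Δ : ℝ) ≤ q
  eps_pos : 0 < ε
  M_pos : 0 < M
  M_large : 100 * (Δ : ℝ) ≤ M * (0.00025 / Δ)
  eps_small : 13 * (2 * (4 * (4 * Δ * ε + 4 * M * ε)) + ε) ≤ 0.00025 / Δ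

/-- The situation at a vertex: the conditional partition functions, up to a common factor. -/
theorem Stable.exists_vertex_data (hp : Params Δ q ε M) (hw : w ∈ Set.Icc (0 : ℝ) 1)
    (hΨ : Ψ.Nonempty) (hA : ∀ u ∈ A, ClosedAt Ψ u) (h : Adm Δ A E c) {v : V}
    (hst : Stable Ψ Δ w ε M (A.erase v)) {z : ℂ} (hz : z ∈ Metric.ball (w : ℂ) ε) :
    ∃ (K : ℂ) (ρ : Fin q → ℂ), K ≠ 0 ∧ (∀ l, ‖ρ l - 1‖ ≤ 4 * M * ε) ∧
      ∀ l, pf Ψ (del E v) (attach (Function.update c v 0) (nbr E v) fun _ => l) z =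
        K * ((pf Ψ (del E v) (attach (Function.update c v 0) (nbr E v) fun _ => l) w /
          pf Ψ (del E v) (Function.update c v 0) w : ℝ) * ρ l) := by
  have hΔ' : (3 : ℝ) ≤ Δ := by exact_mod_cast hp.three_le
  have hqΔ : Δ < q := by
    have : (Δ : ℝ) < q := by linarith [hp.le_q]
    exact_mod_cast this
  have hA' : ∀ u ∈ A.erase v, ClosedAt Ψ u := fun u hu => hA u (Finset.mem_of_mem_erase hu)
  have : Nonempty (Fin q) := ⟨⟨0, by omega⟩⟩
  have hadm : ∀ l : Fin q, Adm Δ (A.erase v) (del E v)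
      (attach (Function.update c v 0) (nbr E v) fun _ => l) := fun l => h.del v subset_rfl _
  have hadm0 : Adm Δ (A.erase v) (del E v) (Function.update c v 0) := by
    have := h.del v (Finset.empty_subset _) fun _ => (⟨0, by omega⟩ : Fin q)
    rwa [attach_empty] at this
  have hD : (0 : ℝ) < (Δ : ℝ) - 1 := by linarith
  refine exists_common_factor
    (X := fun l z => pf Ψ (del E v) (attach (Function.update c v 0) (nbr E v) fun _ => l) z)
    (fun l => differentiable_pf _ _ _) (fun l => pf_pos hw hΨ hqΔ _ hA' _ _ (hadm l))
    (pf_pos hw hΨ hqΔ _ hA' _ _ hadm0) (fun l => (ofReal_pf _ _ _ _).symm)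
    (fun l z hz => hst.ne_zero _ _ (hadm l) z hz) (fun l m z hz => ?_) ?_ hz
  · refine ((hst.vertex hw hp.three_le hp.le_q hΨ hp.M_pos.le hA h l m hz).1).trans ?_
    -- Here `v` may have `Δ` neighbors, so the bound is `2 * M` instead of `M`.
    have h1 : ((nbr E v).card : ℝ) ≤ Δ := by
      exact_mod_cast (Nat.le_add_right _ _).trans (h.degree v)
    have h2 : ((nbr E v).card : ℝ) * (1 / ((Δ : ℝ) - 1)) ≤ 2 := by
      rw [mul_one_div, div_le_iff₀ hD]; linarith
    have := mul_le_mul_of_nonneg_left h2 hp.M_pos.le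
    linarith
  · have h1 := hp.eps_small
    have h2 : 0.00025 / (Δ : ℝ) ≤ 0.0001 := by rw [div_le_iff₀ (by linarith)]; linarith
    have h3 : 0 ≤ (Δ : ℝ) * ε := mul_nonneg (by linarith) hp.eps_pos.le
    have h4 := hp.eps_pos
    linarith

/-- Identifies the coefficient at the current vertex with the ratio in the second bound of `Stable`,
which can thus be handed on. -/
theorem gain_eq {p b P P' : ℝ} (hP : P ≠ 0) (hP' : P' ≠ 0) (h : P' = P * (1 - b * p)) :
    gain b p = P / P' - 1 := by
  have h1 : 1 - b * p ≠ 0 := by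
    rintro h0
    rw [h0, mul_zero] at h
    exact hP' h
  rw [gain, h]
  field_simp
  ring

/-- Up to the factor `K`, the partition function is a perturbation of a real sum `S ≥ 1`, hence
nonzero. The first leaf bound is the contraction; the second needs only `‖y l - y m‖ ≤ M`. -/
theorem Stable.step (hp : Params Δ q ε M) (hw : w ∈ Set.Icc (0 : ℝ) 1)
    (hΨ : Ψ.Nonempty) (hA : ∀ u ∈ A, ClosedAt Ψ u) (h : Adm Δ A E c) {v : V} (hv : v ∈ A)
    (hst : Stable Ψ Δ w ε M (A.erase v)) {z : ℂ} (hz : z ∈ Metric.ball (w : ℂ) ε) :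
    pf Ψ E c z ≠ 0 ∧ ((nbr E v).card + ∑ l, c v l + 1 ≤ Δ → ∀ i j : Fin q,
      ‖logDeriv (fun z => pf Ψ E (attach c {v} fun _ => i) z) z -
        logDeriv (fun z => pf Ψ E (attach c {v} fun _ => j) z) z‖ ≤ M * (1 / ((Δ : ℝ) - 1)) ∧
      ‖logDeriv (fun z => pf Ψ E (attach c {v} fun _ => i) z) z -
        logDeriv (fun z => pf Ψ E (attach c {v} fun _ => j) z) z‖ ≤
          M * ((pf Ψ E c w / pf Ψ E (attach c {v} fun _ => i) w - 1) +
            (pf Ψ E c w / pf Ψ E (attach c {v} fun _ => j) w - 1) + 0.0005 / Δ)) := by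
  obtain ⟨K, ρ, hK, hρ, hXz⟩ := hst.exists_vertex_data hp hw hΨ hA h hz
  have hΔ' : (3 : ℝ) ≤ Δ := by exact_mod_cast hp.three_le
  have hqΔ : Δ < q := by
    have : (Δ : ℝ) < q := by linarith [hp.le_q]
    exact_mod_cast this
  have hq0 : (0 : ℝ) < q := by linarith [hp.le_q]
  have hqc : (q : ℂ) ≠ 0 := by
    have : q ≠ 0 := by omega
    exact_mod_cast this
  have hzε : ‖z - w‖ ≤ ε := (mem_ball_iff_norm.1 hz).le
  have hA' : ∀ u ∈ A.erase v, ClosedAt Ψ u := fun u hu => hA u (Finset.mem_of_mem_erase hu)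
  have hadm : ∀ l : Fin q, Adm Δ (A.erase v) (del E v)
      (attach (Function.update c v 0) (nbr E v) fun _ => l) := fun l => h.del v subset_rfl _
  have hadm0 : Adm Δ (A.erase v) (del E v) (Function.update c v 0) := by
    have := h.del v (Finset.empty_subset _) fun _ => (⟨0, by omega⟩ : Fin q)
    rwa [attach_empty] at this
  have hx : ∀ l, 0 < pf Ψ (del E v) (attach (Function.update c v 0) (nbr E v) fun _ => l) w :=
    fun l => pf_pos hw hΨ hqΔ _ hA' _ _ (hadm l)
  have hx₀ : 0 < pf Ψ (del E v) (Function.update c v 0) w := pf_pos hw hΨ hqΔ _ hA' _ _ hadm0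
  have hle : ∀ l, pf Ψ (del E v) (attach (Function.update c v 0) (nbr E v) fun _ => l) w ≤
      pf Ψ (del E v) (Function.update c v 0) w := fun l => pf_attach_le hw _ _
  have hvert := fun l m => hst.vertex hw hp.three_le hp.le_q hΨ hp.M_pos.le hA h l m hz
  have hlow : ∀ δ : ℕ, (nbr E v).card + ∑ l, c v l ≤ δ → _ := fun δ hδ =>
    le_sum_pow_mul_pf hw (Ψ := Ψ) (del E v) (Function.update c v 0) (nbr E v) (c v) hδ
  have hne : ∀ l, pf Ψ (del E v) (attach (Function.update c v 0) (nbr E v) fun _ => l) z ≠ 0 :=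
    fun l => hst.ne_zero _ _ (hadm l) z hz
  have hreal := card_mul_pf (hA v hv) h.loopless c w
  have hleafreal := fun i => card_mul_pf_attach_singleton (hA v hv) h.loopless c i w
  have hcpx := fun z : ℂ => card_mul_pf (hA v hv) h.loopless c z
  have hleafcpx := fun i (z : ℂ) => card_mul_pf_attach_singleton (hA v hv) h.loopless c i z
  set x₀ := pf Ψ (del E v) (Function.update c v 0) w
  set x : Fin q → ℝ := fun l =>
    pf Ψ (del E v) (attach (Function.update c v 0) (nbr E v) fun _ => l) w with hxdef
  set X : Fin q → ℂ → ℂ := fun l z =>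
    pf Ψ (del E v) (attach (Function.update c v 0) (nbr E v) fun _ => l) z with hXdef
  set W : Fin q → ℝ := fun l => x l / x₀ with hWdef
  have hW0 : ∀ l, 0 < W l := fun l => div_pos (hx l) hx₀
  have hW1 : ∀ l, W l ≤ 1 := fun l => (div_le_one hx₀).2 (hle l)
  have hxW : ∀ l, x l = x₀ * W l := fun l => by
    rw [hWdef]; field_simp
  set S := ∑ l, w ^ c v l * W l with hSdef
  have hxS : ∑ l, w ^ c v l * x l = x₀ * S := by
    rw [hSdef, Finset.mul_sum]
    exact Finset.sum_congr rfl fun l _ => by rw [hxW]; ring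
  have hSlow : ∀ δ : ℕ, (nbr E v).card + ∑ l, c v l ≤ δ → (q : ℝ) - δ ≤ S := by
    intro δ hδ
    have h1 := hlow δ hδ
    change _ ≤ ∑ l, w ^ c v l * x l at h1
    rw [hxS, mul_comm x₀] at h1
    exact le_of_mul_le_mul_right h1 hx₀
  have hS1 : 1 ≤ S := by
    have h1 := hSlow Δ (h.degree v)
    have h2 : ((Δ + 1 : ℕ) : ℝ) ≤ q := by exact_mod_cast hqΔ
    push_cast at h2
    linarith
  have hcΔ : ∑ l, c v l ≤ Δ := (Nat.le_add_left _ _).trans (h.degree v)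
  have hsm := hp.eps_small
  have hsm2 : 0.00025 / (Δ : ℝ) ≤ 0.0001 := by rw [div_le_iff₀ (by linarith)]; linarith
  have hΔε : 0 ≤ (Δ : ℝ) * ε := mul_nonneg (by linarith) hp.eps_pos.le
  have hMε : 0 ≤ M * ε := mul_nonneg hp.M_pos.le hp.eps_pos.le
  have hε := hp.eps_pos
  have hε1 : (Δ : ℝ) * ε ≤ 1 / 2 := by linarith
  have hτ : 4 * Δ * ε + 4 * M * ε ≤ 1 / 2 := by linarith
  have hXz' : ∀ l, X l z = K * (W l * ρ l) := hXz
  have hZz : ∑ l, z ^ c v l * X l z = K * ∑ l, z ^ c v l * W l * ρ l := by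
    rw [Finset.mul_sum]
    exact Finset.sum_congr rfl fun l _ => by rw [hXz']; ring
  have hSz := half_le_norm_sum_weight hw hzε hε1 hcΔ (fun l => (hW0 l).le) hW1 hρ hτ hS1
  have hSz0 : ∑ l, z ^ c v l * W l * ρ l ≠ 0 := norm_pos_iff.1 (by linarith)
  have hZne : ∑ l, z ^ c v l * X l z ≠ 0 := by
    rw [hZz]; exact mul_ne_zero hK hSz0
  refine ⟨fun h0 => hZne ?_, fun hdeg i j => ?_⟩
  · have := hcpx z
    rw [h0, mul_zero] at this
    exact this.symm
  have hSD : (q : ℝ) - (Δ - 1) ≤ S := by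
    have h1 := hSlow (Δ - 1) (by omega)
    rwa [Nat.cast_sub (by omega), Nat.cast_one] at h1
  have hS0 : 0 < S := by linarith
  set p : Fin q → ℝ := fun l => w ^ c v l * W l / S with hpdef
  set pz : Fin q → ℂ := fun l => z ^ c v l * X l z / ∑ m, z ^ c v m * X m z with hpzdef
  set y : Fin q → ℂ := fun l => logDeriv (X l) z with hydef
  set e : Fin q → ℂ := fun l =>
    c v l * z ^ (c v l - 1) * X l z / ∑ m, z ^ c v m * X m z with hedef
  have hθ0 : ∀ l, 0 ≤ w ^ c v l := fun l => pow_nonneg hw.1 _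
  have hθ1 : ∀ l, w ^ c v l ≤ 1 := fun l => pow_le_one₀ hw.1 hw.2
  have hp0 : ∀ l, 0 ≤ p l := fun l => div_nonneg (mul_nonneg (hθ0 l) (hW0 l).le) hS0.le
  have hp3 : ∀ l, p l ≤ 1 / 3 := by
    intro l
    rw [hpdef]
    simp only
    rw [div_le_iff₀ hS0]
    have := mul_le_one₀ (hθ1 l) (hW0 l).le (hW1 l)
    linarith [hp.le_q]
  have hsum : ∑ l, p l = 1 := by rw [hpdef, ← Finset.sum_div, ← hSdef, div_self hS0.ne']
  have hsumz : ∑ l, pz l = 1 := by rw [hpzdef, ← Finset.sum_div, div_self hZne]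
  have hpz : ∑ l, ‖pz l - p l‖ ≤ 4 * (4 * Δ * ε + 4 * M * ε) := by
    have := sum_norm_marginal_sub_le hw hzε hε1 hcΔ (fun l => (hW0 l).le) hW1 hρ hτ hS1
    refine le_of_eq_of_le (Finset.sum_congr rfl fun l _ => ?_) this
    rw [hpzdef]
    simp only
    rw [hZz, hXz' l]
    congr 2
    field_simp
  have he : ∑ l, ‖e l‖ ≤ 8 * Δ := by
    have := sum_norm_explicit_le hw hzε hε1 hcΔ (fun l => (hW0 l).le) hW1 hρ hτ hS1
    refine le_of_eq_of_le (Finset.sum_congr rfl fun l _ => ?_) this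
    rw [hedef]
    simp only
    rw [hZz, hXz' l]
    congr 1
    field_simp
  have hyM : ∀ l m, ‖y l - y m‖ ≤ M := by
    intro l m
    refine (hvert l m).1.trans ?_
    have h1 : ((nbr E v).card : ℝ) + 1 ≤ Δ := by exact_mod_cast (by omega)
    have h2 : ((nbr E v).card : ℝ) * (1 / ((Δ : ℝ) - 1)) ≤ 1 := by
      rw [mul_one_div, div_le_iff₀ (by linarith)]; linarith
    have := mul_le_mul_of_nonneg_left h2 hp.M_pos.le
    linarith
  have hσ : 2 * (4 * (4 * Δ * ε + 4 * M * ε)) + ε ≤ 1 / 6 := by linarith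
  have hbound := norm_leafLogDeriv_sub_le hw hzε hsumz hsum hp0 hp3 hpz hσ he hp.three_le hyM i j
  have hlog : ∀ i, logDeriv (fun z => pf Ψ E (attach c {v} fun _ => i) z) z =
      leafLogDeriv z pz y e i := by
    intro i
    have hpl : ‖pz i - p i‖ ≤ 4 * (4 * Δ * ε + 4 * M * ε) :=
      (Finset.single_le_sum (fun l _ => norm_nonneg (pz l - p l)) (Finset.mem_univ i)).trans hpz
    have h1 := (gain_perturb hw hzε (hp0 i) (hp3 i) hpl hσ).1
    have h2 := logDeriv_leaf (X := X) (fun l => differentiable_pf _ _ _) (c v) hne hZne i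
      (norm_pos_iff.1 (by linarith))
    rw [← h2, ← logDeriv_const_mul z (q : ℂ) hqc]
    congr 1
    funext z'
    rw [hleafcpx i z', hcpx z']
  rw [hlog i, hlog j]
  have hPpos : 0 < pf Ψ E c w := pf_pos hw hΨ hqΔ A hA E c h
  have hP : q * pf Ψ E c w = x₀ * S := by rw [← hxS]; exact hreal
  have hgain : ∀ i, gain (1 - w) (p i) =
      pf Ψ E c w / pf Ψ E (attach c {v} fun _ => i) w - 1 := by
    intro i
    have h1 : pf Ψ E (attach c {v} fun _ => i) w = pf Ψ E c w * (1 - (1 - w) * p i) := by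
      have h2 := hleafreal i
      change _ = _ - (1 - w) * (w ^ c v i * x i) at h2
      have h3 : w ^ c v i * x i = q * pf Ψ E c w * p i := by
        rw [hP, hxW i, hpdef]; field_simp
      rw [h3] at h2
      have : (q : ℝ) * pf Ψ E (attach c {v} fun _ => i) w =
          q * (pf Ψ E c w * (1 - (1 - w) * p i)) := by rw [h2]; ring
      exact mul_left_cancel₀ hq0.ne' this
    refine gain_eq hPpos.ne' ?_ h1
    rw [h1]
    refine mul_ne_zero hPpos.ne' ?_
    have : (1 - w) * p i ≤ p i := mul_le_of_le_one_left (hp0 i) (by linarith [hw.1])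
    have := hp3 i
    linarith
  rw [← hgain i, ← hgain j]
  -- The reserve `M * (0.0005 / Δ)` is shared equally between the perturbed marginals (`eps_small`)
  -- and the explicit terms (`M_large`).
  have herr : 13 * (2 * (4 * (4 * Δ * ε + 4 * M * ε)) + ε) * M + 100 * Δ ≤ M * (0.0005 / Δ) := by
    have h1 := mul_le_mul_of_nonneg_right hsm hp.M_pos.le
    have h2 := hp.M_large
    have : M * (0.0005 / Δ) = 0.00025 / Δ * M + M * (0.00025 / Δ) := by ring
    linarith
  have hb : 1 - w ∈ Set.Icc (0 : ℝ) 1 := ⟨by linarith [hw.2], by linarith [hw.1]⟩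
  have hM2 : 500 ≤ Δ → ∀ l m,
      ‖y l - y m‖ ≤ M * (6.1 * (1 - W l) - 1.003 * Real.log (W m) + 0.0005) :=
    fun h5 l m => (hvert l m).2 (by omega) h5
  have hcontr := fun i j (hij : gain (1 - w) (p j) ≤ gain (1 - w) (p i)) =>
    norm_gain_diff_le_contraction hp.three_le hp.le_q (Fintype.card_fin q) hb hW0 hW1 hθ0 hθ1 hSD
      hyM hM2 i j hij
  have hsimple : ∀ i j, gain (1 - w) (p j) ≤ gain (1 - w) (p i) →
      ‖(gain (1 - w) (p i) : ℂ) * (y i - ∑ l, p l * y l) -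
        (gain (1 - w) (p j) : ℂ) * (y j - ∑ l, p l * y l)‖ ≤
        M * (gain (1 - w) (p i) + gain (1 - w) (p j)) := by
    intro i j hij
    have hgj := gain_nonneg hb (hp0 j) (hp3 j)
    refine (norm_gain_diff_le (y := y) hp0 hsum hgj hij i j).trans ?_
    have h1 := mul_le_mul_of_nonneg_left (hyM i j) hgj
    have h2 := mul_le_mul_of_nonneg_left (average_le hp0 hsum fun l => hyM i l)
      (sub_nonneg.2 hij)
    have h3 := mul_nonneg hgj hp.M_pos.le
    linarith
  have hT : ‖(gain (1 - w) (p i) : ℂ) * (y i - ∑ l, p l * y l) -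
        (gain (1 - w) (p j) : ℂ) * (y j - ∑ l, p l * y l)‖ ≤
        M * (1 / ((Δ : ℝ) - 1) - 0.0005 / Δ) ∧
      ‖(gain (1 - w) (p i) : ℂ) * (y i - ∑ l, p l * y l) -
        (gain (1 - w) (p j) : ℂ) * (y j - ∑ l, p l * y l)‖ ≤
        M * (gain (1 - w) (p i) + gain (1 - w) (p j)) := by
    rcases le_total (gain (1 - w) (p j)) (gain (1 - w) (p i)) with hij | hij
    · exact ⟨hcontr i j hij, hsimple i j hij⟩
    · rw [norm_sub_rev, add_comm]
      exact ⟨hcontr j i hij, hsimple j i hij⟩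
  constructor
  · refine hbound.trans ?_
    have := hT.1
    rw [mul_sub] at this
    linarith
  · refine hbound.trans ?_
    have := hT.2
    rw [mul_add M (_ + _)]
    linarith

/-- For nonvanishing any active vertex may be deleted; for the leaf bound it has to be the one
carrying the leaf. -/
theorem stable_of_params (hp : Params Δ q ε M) (hw : w ∈ Set.Icc (0 : ℝ) 1) (hΨ : Ψ.Nonempty) :
    ∀ A : Finset V, (∀ u ∈ A, ClosedAt Ψ u) → Stable Ψ Δ w ε M A := by
  intro A
  induction A using Finset.strongInduction with
  | H A ih =>
    intro hA
    have hst : ∀ v ∈ A, Stable Ψ Δ w ε M (A.erase v) := fun v hv =>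
      ih _ (Finset.erase_ssubset hv) fun u hu => hA u (Finset.mem_of_mem_erase hu)
    refine ⟨fun E c h z hz => ?_, fun E c h u hu hdeg i j z hz => ?_⟩
    · rcases A.eq_empty_or_nonempty with rfl | ⟨v, hv⟩
      · have hE : E = ∅ := by
          refine Finset.eq_empty_of_forall_notMem fun e he => ?_
          induction e with | _ a b
          simpa using h.supp _ he a (by simp)
        have hc : c = 0 := funext fun u => h.field u (by simp)
        subst hE hc
        simpa [pf, expo] using hΨ.ne_empty
      · exact (Stable.step hp hw hΨ hA h hv (hst v hv) hz).1
    · exact (Stable.step hp hw hΨ hA h hu (hst u hu) hz).2 hdeg i j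

end Potts

/-! ### From partially colored graphs to leaf counts. -/

namespace PartiallyColoredGraph

open Potts

section Model

variable {V : Type*} [Fintype V] {q : ℕ} (P : PartiallyColoredGraph V q)

open Classical in
/-- The edges between free vertices. -/
noncomputable def freeEdges : Finset (Sym2 V) :=
  Finset.univ.filter fun e => e ∈ P.graph.edgeSet ∧ ∀ u ∈ e, u ∉ P.pinned

open Classical in
/-- The pinned neighbors of `u` with color `l`. -/
noncomputable def pinnedNbr (u : V) (l : Fin q) : Finset V :=
  Finset.univ.filter fun s => u ∉ P.pinned ∧ P.graph.Adj u s ∧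
    ∃ h : s ∈ P.pinned, P.color ⟨s, h⟩ = l

/-- The number of pinned neighbors of `u` with color `l`. -/
noncomputable def leaves (u : V) (l : Fin q) : ℕ := (P.pinnedNbr u l).card

open Classical in
/-- The free vertices. -/
noncomputable def free : Finset V := Finset.univ.filter fun u => u ∉ P.pinned

open Classical in
/-- The colorings that extend the given one. -/
noncomputable def extensions : Finset (V → Fin q) := Finset.univ.filter P.Extends

theorem mem_freeEdges {e : Sym2 V} :
    e ∈ P.freeEdges ↔ e ∈ P.graph.edgeSet ∧ ∀ u ∈ e, u ∉ P.pinned := by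
  simp [freeEdges]

theorem mem_pinnedNbr {u s : V} {l : Fin q} : s ∈ P.pinnedNbr u l ↔
    u ∉ P.pinned ∧ P.graph.Adj u s ∧ ∃ h : s ∈ P.pinned, P.color ⟨s, h⟩ = l := by
  simp [pinnedNbr]

theorem mem_free {u : V} : u ∈ P.free ↔ u ∉ P.pinned := by
  simp [free]

theorem mem_extensions {ψ : V → Fin q} : ψ ∈ P.extensions ↔ P.Extends ψ := by
  simp [extensions]

/-- Independence excludes edges between pinned vertices; an edge from a free to a pinned vertex acts
as a leaf of the prescribed color. -/
theorem numMono_eq [DecidableEq V] (hind : P.graph.IsIndepSet P.pinned) {ψ : V → Fin q}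
    (hψ : P.Extends ψ) : P.numMono ψ = expo P.freeEdges P.leaves ψ := by
  classical
  have h1 : P.numMono ψ = (Finset.univ.filter fun e : Sym2 V =>
      e ∈ P.graph.edgeSet ∧ (e.map ψ).IsDiag).card := by
    rw [numMono, ← Set.ncard_coe_finset]
    simp
  rw [h1, ← Finset.card_filter_add_card_filter_not (fun e : Sym2 V => ∀ u ∈ e, u ∉ P.pinned),
    expo]
  congr 1
  · congr 1
    ext e
    simp only [freeEdges, Finset.mem_filter, Finset.mem_univ, true_and]
    tauto
  · simp only [leaves]
    rw [← Finset.card_sigma]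
    symm
    refine Finset.card_bij (fun x _ => s(x.1, x.2)) ?_ ?_ ?_
    · rintro ⟨u, s⟩ hx
      simp only [mem_pinnedNbr, Finset.mem_sigma, Finset.mem_univ, true_and] at hx
      obtain ⟨hu, hadj, hs, hcol⟩ := hx
      simp only [Finset.mem_filter, Finset.mem_univ, true_and, SimpleGraph.mem_edgeSet,
        Sym2.map_mk, Sym2.mk_isDiag_iff]
      refine ⟨⟨hadj, ?_⟩, fun hall => hall s (by simp) hs⟩
      rw [hψ ⟨s, hs⟩, hcol]
    · rintro ⟨u, s⟩ hx ⟨u', s'⟩ hx' h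
      simp only [mem_pinnedNbr, Finset.mem_sigma, Finset.mem_univ, true_and] at hx hx'
      simp only [Sym2.eq_iff] at h
      rcases h with ⟨rfl, rfl⟩ | ⟨rfl, rfl⟩
      · rfl
      · obtain ⟨hs, -⟩ := hx'.2.2
        exact absurd hs hx.1
    · intro e he
      induction e with | _ a b
      simp only [Finset.mem_filter, Finset.mem_univ, true_and, SimpleGraph.mem_edgeSet,
        Sym2.map_mk, Sym2.mk_isDiag_iff, Sym2.mem_iff, forall_eq_or_imp, forall_eq, not_and_or,
        not_not] at he
      obtain ⟨⟨hadj, hab⟩, ha | hb⟩ := he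
      · have hb : b ∉ P.pinned := fun hb => hind ha hb hadj.ne hadj
        refine ⟨⟨b, a⟩, ?_, Sym2.eq_swap⟩
        simp only [mem_pinnedNbr, Finset.mem_sigma, Finset.mem_univ, true_and]
        exact ⟨hb, hadj.symm, ha, by rw [← hψ ⟨a, ha⟩, hab]⟩
      · have ha : a ∉ P.pinned := fun ha => hind ha hb hadj.ne hadj
        refine ⟨⟨a, b⟩, ?_, rfl⟩
        simp only [mem_pinnedNbr, Finset.mem_sigma, Finset.mem_univ, true_and]
        exact ⟨ha, hadj, hb, by rw [← hψ ⟨b, hb⟩, hab]⟩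

theorem mem_nbr_freeEdges [DecidableEq V] {u x : V} :
    x ∈ nbr P.freeEdges u ↔ P.graph.Adj u x ∧ u ∉ P.pinned ∧ x ∉ P.pinned := by
  simp [mem_nbr, freeEdges]

theorem card_nbr_freeEdges_le [DecidableEq V] (u : V) :
    (nbr P.freeEdges u).card ≤ P.freeDegree u := by
  rw [freeDegree, ← Set.ncard_coe_finset]
  refine Set.ncard_le_ncard (fun x hx => ?_) (Set.toFinite _)
  have := P.mem_nbr_freeEdges.1 (Finset.mem_coe.1 hx)
  exact ⟨this.1, this.2.2⟩

theorem adm [DecidableEq V] {Δ : ℕ} (hdeg : ∀ u, (P.graph.neighborSet u).ncard ≤ Δ) :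
    Adm Δ P.free P.freeEdges P.leaves where
  loopless e he := P.graph.not_isDiag_of_mem_edgeSet (P.mem_freeEdges.1 he).1
  supp e he u hu := P.mem_free.2 ((P.mem_freeEdges.1 he).2 u hu)
  field u hu := by
    have hu : u ∈ P.pinned := by simpa [mem_free] using hu
    funext l
    simp [leaves, pinnedNbr, hu]
  degree u := by
    classical
    refine le_trans ?_ (hdeg u)
    have hdisj : ∀ a b : Fin q, a ≠ b →
        Disjoint (P.pinnedNbr u a) (P.pinnedNbr u b) := by
      intro a b hab
      refine Finset.disjoint_left.2 fun s hs hs' => hab ?_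
      obtain ⟨-, -, h, rfl⟩ := P.mem_pinnedNbr.1 hs
      obtain ⟨-, -, h', rfl⟩ := P.mem_pinnedNbr.1 hs'
      rfl
    simp only [leaves]
    rw [← Finset.card_biUnion (fun a _ b _ hab => hdisj a b hab),
      ← Finset.card_union_of_disjoint, ← Set.ncard_coe_finset]
    · refine Set.ncard_le_ncard (fun x hx => ?_) (Set.toFinite _)
      rcases Finset.mem_union.1 (Finset.mem_coe.1 hx) with hx | hx
      · exact (P.mem_nbr_freeEdges.1 hx).1
      · obtain ⟨l, -, hl⟩ := Finset.mem_biUnion.1 hx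
        exact (P.mem_pinnedNbr.1 hl).2.1
    · refine Finset.disjoint_left.2 fun s hs hs' => ?_
      obtain ⟨l, -, hl⟩ := Finset.mem_biUnion.1 hs'
      obtain ⟨h, -⟩ := (P.mem_pinnedNbr.1 hl).2.2
      exact (P.mem_nbr_freeEdges.1 hs).2.2 h

theorem closedAt_extensions [DecidableEq V] {u : V} (hu : u ∈ P.free) :
    ClosedAt P.extensions u := by
  intro ψ hψ l
  refine P.mem_extensions.2 fun s => ?_
  have hs : (s : V) ≠ u := fun h => P.mem_free.1 hu (h ▸ s.2)
  rw [Function.update_of_ne hs]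
  exact P.mem_extensions.1 hψ s

theorem extensions_nonempty (hq : 0 < q) : P.extensions.Nonempty := by
  classical
  refine ⟨fun u => if h : u ∈ P.pinned then P.color ⟨u, h⟩ else ⟨0, hq⟩,
    P.mem_extensions.2 fun s => ?_⟩
  simp

end Model

section Translation

variable {V : Type*} [Finite V] {q : ℕ} (P : PartiallyColoredGraph V q)

theorem Z_eq [DecidableEq V] (hind : P.graph.IsIndepSet P.pinned) (z : ℂ) :
    letI := Fintype.ofFinite V
    P.Z z = pf P.extensions P.freeEdges P.leaves z := by
  classical
  let := Fintype.ofFinite V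
  simp only [Z, pf]
  refine Finset.sum_congr (by ext; simp [mem_extensions]) fun ψ hψ => ?_
  rw [P.numMono_eq hind (P.mem_extensions.1 hψ)]

theorem ZAt_eq [DecidableEq V] (hind : P.graph.IsIndepSet P.pinned) (v : V) (l : Fin q) (z : ℂ) :
    letI := Fintype.ofFinite V
    P.ZAt v l z = ∑ ψ ∈ P.extensions with ψ v = l, z ^ expo P.freeEdges P.leaves ψ := by
  classical
  let := Fintype.ofFinite V
  simp only [ZAt]
  refine Finset.sum_congr (by ext; simp [mem_extensions]) fun ψ hψ => ?_
  rw [P.numMono_eq hind (P.mem_extensions.1 (Finset.mem_filter.1 hψ).1)]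

variable {Δ : ℕ} {ε M w : ℝ}

theorem Z_ne_zero (hp : Params Δ q ε M) (hw : w ∈ Set.Icc (0 : ℝ) 1)
    (hdeg : ∀ u, (P.graph.neighborSet u).ncard ≤ Δ) (hind : P.graph.IsIndepSet P.pinned)
    {z : ℂ} (hz : z ∈ Metric.ball (w : ℂ) ε) : P.Z z ≠ 0 := by
  classical
  let := Fintype.ofFinite V
  have hq : 0 < q := by
    have h1 : (3 : ℝ) ≤ Δ := by exact_mod_cast hp.three_le
    have : (0 : ℝ) < q := by linarith [hp.le_q]
    exact_mod_cast this
  rw [P.Z_eq hind]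
  exact (stable_of_params hp hw (P.extensions_nonempty hq) P.free
    fun u hu => P.closedAt_extensions hu).ne_zero _ _ (P.adm hdeg) z hz

/-- Near `[0, 1]` the conditional partition functions at a free vertex without pinned neighbors
change by nearly the same factor. -/
theorem exists_ratio_eq (hp : Params Δ q ε M) (hw : w ∈ Set.Icc (0 : ℝ) 1)
    (hdeg : ∀ u, (P.graph.neighborSet u).ncard ≤ Δ) (hind : P.graph.IsIndepSet P.pinned)
    {v : V} (hv : v ∉ P.pinned) (hfree : P.freeDegree v ≤ Δ - 1)
    (hpin : ∀ u, P.graph.Adj v u → u ∉ P.pinned) (i j : Fin q)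
    {z : ℂ} (hz : z ∈ Metric.ball (w : ℂ) ε) :
    P.ZAt v i z ≠ 0 ∧ P.ZAt v j z ≠ 0 ∧ ∃ r : ℝ, 0 < r ∧ P.ratio v i j w = r ∧
      ∃ s : ℂ, ‖s‖ ≤ M * ε ∧ P.ratio v i j z = r * Complex.exp s := by
  classical
  let := Fintype.ofFinite V
  have hΔ : (3 : ℝ) ≤ Δ := by exact_mod_cast hp.three_le
  have hqΔ : Δ < q := by
    have : (Δ : ℝ) < q := by linarith [hp.le_q]
    exact_mod_cast this
  have hqc : (q : ℂ) ≠ 0 := by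
    have : q ≠ 0 := by omega
    exact_mod_cast this
  have hΨ := P.extensions_nonempty (by omega)
  have hA : ∀ u ∈ P.free, ClosedAt P.extensions u := fun u hu => P.closedAt_extensions hu
  have hA' : ∀ u ∈ P.free.erase v, ClosedAt P.extensions u :=
    fun u hu => hA u (Finset.mem_of_mem_erase hu)
  have hvf : v ∈ P.free := P.mem_free.2 hv
  have hadm := P.adm hdeg
  have hst := stable_of_params hp hw hΨ (P.free.erase v) hA'
  have hadm' : ∀ l : Fin q, Adm Δ (P.free.erase v) (del P.freeEdges v)
      (attach (Function.update P.leaves v 0) (nbr P.freeEdges v) fun _ => l) :=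
    fun l => hadm.del v subset_rfl _
  -- So no power of `z` splits off at `v`; such a power could vanish at `z = 0`. This is the role of
  -- removing the pinned neighbors of the root.
  have hleaf : ∀ l, P.leaves v l = 0 := by
    intro l
    rw [leaves, Finset.card_eq_zero]
    refine Finset.eq_empty_of_forall_notMem fun s hs => ?_
    obtain ⟨-, hadj, h, -⟩ := P.mem_pinnedNbr.1 hs
    exact hpin s hadj h
  have hZ : ∀ l (z : ℂ), (q : ℂ) * P.ZAt v l z = pf P.extensions (del P.freeEdges v)
      (attach (Function.update P.leaves v 0) (nbr P.freeEdges v) fun _ => l) z := by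
    intro l z
    rw [P.ZAt_eq hind, card_mul_pf_at (hA v hvf) hadm.loopless, hleaf, pow_zero, one_mul]
  have hratio : ∀ z : ℂ, P.ratio v i j z =
      pf P.extensions (del P.freeEdges v)
        (attach (Function.update P.leaves v 0) (nbr P.freeEdges v) fun _ => i) z /
      pf P.extensions (del P.freeEdges v)
        (attach (Function.update P.leaves v 0) (nbr P.freeEdges v) fun _ => j) z := by
    intro z
    rw [ratio, ← hZ, ← hZ, mul_div_mul_left _ _ hqc]
  have hne : ∀ l, P.ZAt v l z ≠ 0 := by
    intro l h0
    have := hst.ne_zero _ _ (hadm' l) z hz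
    rw [← hZ, h0, mul_zero] at this
    exact this rfl
  have hpos := fun l => pf_pos hw hΨ hqΔ _ hA' _ _ (hadm' l)
  refine ⟨hne i, hne j, _, div_pos (hpos i) (hpos j), ?_, ?_⟩
  · rw [hratio, ← ofReal_pf, ← ofReal_pf, ← Complex.ofReal_div]
  · have hlog : ∀ z ∈ Metric.ball (w : ℂ) ε,
        ‖logDeriv (fun z => pf P.extensions (del P.freeEdges v)
            (attach (Function.update P.leaves v 0) (nbr P.freeEdges v) fun _ => i) z) z -
          logDeriv (fun z => pf P.extensions (del P.freeEdges v)
            (attach (Function.update P.leaves v 0) (nbr P.freeEdges v) fun _ => j) z) z‖ ≤ M := by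
      intro z hz
      refine ((hst.vertex hw hp.three_le hp.le_q hΨ hp.M_pos.le hA hadm i j hz).1).trans ?_
      have h1 : (nbr P.freeEdges v).card + 1 ≤ Δ := by
        have := (P.card_nbr_freeEdges_le v).trans hfree
        have := hp.three_le
        omega
      have h1' : ((nbr P.freeEdges v).card : ℝ) + 1 ≤ Δ := by exact_mod_cast h1
      have h2 : ((nbr P.freeEdges v).card : ℝ) * (1 / ((Δ : ℝ) - 1)) ≤ 1 := by
        rw [mul_one_div, div_le_iff₀ (by linarith)]; linarith
      have := mul_le_mul_of_nonneg_left h2 hp.M_pos.le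
      linarith
    obtain ⟨s, hs, hs'⟩ := exists_exp_of_logDeriv_sub_le (differentiable_pf _ _ _)
      (differentiable_pf _ _ _) (fun z hz => hst.ne_zero _ _ (hadm' i) z hz)
      (fun z hz => hst.ne_zero _ _ (hadm' j) z hz) hlog hz
    refine ⟨s, hs.trans (mul_le_mul_of_nonneg_left (mem_ball_iff_norm.1 hz).le hp.M_pos.le), ?_⟩
    rw [hratio, hs', ← ofReal_pf, ← ofReal_pf, ← Complex.ofReal_div]

end Translation

/-- As `|s.im| ≤ 1 < π`, the argument stays on the principal branch. -/
theorem log_ofReal_mul_exp {r : ℝ} (hr : 0 < r) {s : ℂ} (hs : ‖s‖ ≤ 1) :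
    (r : ℂ) * Complex.exp s ∈ Complex.slitPlane ∧
      Complex.log (r * Complex.exp s) = Complex.log r + s := by
  have him : |s.im| ≤ 1 := (Complex.abs_im_le_norm s).trans hs
  have h1 := abs_le.1 him
  have hpi := Real.pi_gt_three
  have hlog : Complex.log (Complex.exp s) = s := Complex.log_exp (by linarith) (by linarith)
  constructor
  · rw [Complex.mem_slitPlane_iff_arg]
    refine ⟨?_, mul_ne_zero (by exact_mod_cast hr.ne') (Complex.exp_ne_zero _)⟩
    rw [Complex.arg_real_mul _ hr, ← Complex.log_im, hlog]
    linarith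
  · rw [Complex.log_ofReal_mul hr (Complex.exp_ne_zero _), hlog, Complex.ofReal_log hr.le]

section Bar

variable {V : Type*} {q : ℕ} (P : PartiallyColoredGraph V q)

theorem ncard_neighborSet_bar_le [Finite V] (v : V) (u : P.barSet v) :
    ((P.bar v).graph.neighborSet u).ncard ≤ (P.graph.neighborSet u).ncard :=
  Set.ncard_le_ncard_of_injOn Subtype.val (fun _ hx => hx) Subtype.val_injective.injOn
    (Set.toFinite _)

theorem freeDegree_bar_le [Finite V] (v : V) :
    (P.bar v).freeDegree (P.barRoot v) ≤ P.freeDegree v :=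
  Set.ncard_le_ncard_of_injOn Subtype.val (fun _ hx => hx) Subtype.val_injective.injOn
    (Set.toFinite _)

theorem isIndepSet_bar (hind : P.graph.IsIndepSet P.pinned) (v : V) :
    (P.bar v).graph.IsIndepSet (P.bar v).pinned :=
  fun _ ha _ hb hab => hind ha hb (Subtype.coe_injective.ne hab)

end Bar

end PartiallyColoredGraph

/-! ### Choice of the constants and conclusion. -/

theorem Potts.params_of_le {Δ q : ℕ} (hΔ : 3 ≤ Δ) (hq : 1.998 * (Δ : ℝ) ≤ q) :
    Potts.Params Δ q (1 / 10 ^ 14 * ((Δ : ℝ) ^ 4)⁻¹) (400000 * (Δ : ℝ) ^ 2) := by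
  have hΔ' : (3 : ℝ) ≤ Δ := by exact_mod_cast hΔ
  have h0 : (0 : ℝ) < Δ := by linarith
  -- The value of `M` makes `M_large` an equality.
  refine ⟨hΔ, hq, by positivity, by positivity, le_of_eq (by field_simp; norm_num), ?_⟩
  rw [le_div_iff₀ h0]
  have : 13 * (2 * (4 * (4 * (Δ : ℝ) * (1 / 10 ^ 14 * ((Δ : ℝ) ^ 4)⁻¹) +
      4 * (400000 * (Δ : ℝ) ^ 2) * (1 / 10 ^ 14 * ((Δ : ℝ) ^ 4)⁻¹))) +
        1 / 10 ^ 14 * ((Δ : ℝ) ^ 4)⁻¹) * Δ =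
      13 / 10 ^ 14 * (32 * Δ + 12800000 * (Δ : ℝ) ^ 2 + 1) / (Δ : ℝ) ^ 3 := by
    field_simp
    ring
  rw [this, div_le_iff₀ (by positivity)]
  have h2 : (Δ : ℝ) ^ 2 ≤ (Δ : ℝ) ^ 3 := pow_le_pow_right₀ (by linarith) (by norm_num)
  nlinarith

theorem theorem2p1 :
    ∃ η : ℝ, 0.002 ≤ η ∧ ∃ C : ℝ, 0 < C ∧
      ∀ Δ q : ℕ, 3 ≤ Δ → (2 - η) * (Δ : ℝ) ≤ (q : ℝ) →
        ∃ ε₁ ε₂ : ℝ, 0 < ε₁ ∧ 0 < ε₂ ∧ C * ((Δ : ℝ) ^ 4)⁻¹ ≤ ε₁ ∧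
          ∀ (V : Type*) [Finite V] (P : PartiallyColoredGraph V q) (v : V),
            P.IsRooted Δ v → P.freeDegree v ≤ Δ - 1 →
              ∀ w : ℝ, w ∈ Set.Icc (0 : ℝ) 1 → ∀ w' : ℂ, w' ∈ Metric.ball (w : ℂ) ε₁ →
                P.Z w' ≠ 0 ∧
                ∀ i j : Fin q,
                  (P.bar v).LogRatioDefined (P.barRoot v) i j (w : ℂ) ∧
                  (P.bar v).LogRatioDefined (P.barRoot v) i j w' ∧
                  ‖(P.bar v).logRatio (P.barRoot v) i j w' -
                    (P.bar v).logRatio (P.barRoot v) i j (w : ℂ)‖ ≤ ε₂ := by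
  refine ⟨0.002, le_rfl, 1 / 10 ^ 14, by norm_num, fun Δ q hΔ hq => ?_⟩
  have hp := Potts.params_of_le hΔ (by linarith : 1.998 * (Δ : ℝ) ≤ q)
  -- Here `ε₂ = M * ε₁`: the logarithm of the ratio has derivative at most `M` on a disc of radius
  -- `ε₁`.
  refine ⟨_, _, hp.eps_pos, mul_pos hp.M_pos hp.eps_pos, le_rfl, ?_⟩
  intro V _ P v hR hfree w hw w' hw'
  have hΔ' : (3 : ℝ) ≤ Δ := by exact_mod_cast hΔ
  have hsmall : 400000 * (Δ : ℝ) ^ 2 * (1 / 10 ^ 14 * ((Δ : ℝ) ^ 4)⁻¹) ≤ 1 := by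
    have h1 := hp.eps_small
    have h2 : 0.00025 / (Δ : ℝ) ≤ 0.0001 := by rw [div_le_iff₀ (by linarith)]; linarith
    have h3 : 0 ≤ (Δ : ℝ) * (1 / 10 ^ 14 * ((Δ : ℝ) ^ 4)⁻¹) := by positivity
    have h4 := hp.eps_pos
    linarith
  refine ⟨P.Z_ne_zero hp hw hR.degree_le hR.pinned_indep hw', fun i j => ?_⟩
  have key := fun (z : ℂ) hz => (P.bar v).exists_ratio_eq hp hw
    (fun u => (P.ncard_neighborSet_bar_le v u).trans (hR.degree_le u))
    (P.isIndepSet_bar hR.pinned_indep v) (v := P.barRoot v) hR.root_free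
    ((P.freeDegree_bar_le v).trans hfree) (fun u hu hpin => u.2 ⟨hu, hpin⟩) i j (z := z) hz
  obtain ⟨h1, h2, r, hr, hrw, s, hs, hsz⟩ := key w' hw'
  obtain ⟨h1w, h2w, -⟩ := key w (Metric.mem_ball_self hp.eps_pos)
  obtain ⟨hslit, hlog⟩ := PartiallyColoredGraph.log_ofReal_mul_exp hr (hs.trans hsmall)
  refine ⟨⟨h1w, h2w, ?_⟩, ⟨h1, h2, ?_⟩, ?_⟩
  · rw [hrw]
    exact Complex.ofReal_mem_slitPlane.2 hr
  · rw [hsz]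
    exact hslit
  · rw [PartiallyColoredGraph.logRatio, PartiallyColoredGraph.logRatio, hsz, hrw, hlog,
      add_sub_cancel_left]
    exact hs
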